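/- Let $\Bbbk$ be a field, $V$ a finite-dimensional $\Bbbk$-vector space with basis $(v_i)$, $c$ an invertible endomorphism of $V\otimes V$ and $t$ an endomorphism of $V\otimes V$. Write $f_{12}=f\otimes\mathrm{Id}$, $f_{23}=\mathrm{Id}\otimes f$ on $V^{\otimes 3}$ and $f(v_i\otimes v_j)=\sum_{k,\ell} f_{ij}^{k\ell}\,v_k\otimes v_\ell$ for $f\in\mathrm{End}(V\otimes V)$. Assume that $(V,c,t)$ is an infinitesimally braided vector space, i.e. that on $V^{\otimes 3}$ $$c_{12}c_{23}c_{12}=c_{23}c_{12}c_{23},\qquad c_{23}t_{12}c_{23}^{-1}=c_{12}^{-1}t_{23}c_{12}=c_{23}^{-1}t_{12}c_{23}=c_{12}t_{23}c_{12}^{-1},$$ $$[\,t_{12}+c_{12}t_{23}c_{12}^{-1},\,t_{23}\,]=0,\qquad [\,t_{23}+c_{23}t_{12}c_{23}^{-1},\,t_{12}\,]=0 .$$ Let $F$ be the free algebra on indeterminates $T_i^j$, a bialgebra with $\Delta(T_i^j)=\sum_k T_i^k\otimes T_k^j$ and $\varepsilon(T_i^j)=\delta_i^j$. Let $A(c)=F/I(c)$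 with $I(c)$ the two-sided ideal generated by all $\sum_{m,n} \big(c_{ij}^{mn}T_m^kT_n^\ell-T_i^mT_j^n c_{mn}^{k\ell}\big)$, and let $A(c,t)=A(c)/I(t)$ with $I(t)$ the two-sided ideal of $A(c)$ generated by all $\sum_{m,n}\big(t_{ij}^{mn}T_m^kT_n^\ell-T_i^mT_j^n t_{mn}^{k\ell}\big)$; both are quotient bialgebras. A coquasitriangular structure on a bialgebra $H$ is a convolution-invertible linear map $\mathcal R\colon H\otimes H\to\Bbbk$ such that, for all $a,b,c\in H$ (Sweedler notation), $\mathcal R(a_1\otimes b_1)a_2b_2=b_1a_1\mathcal R(a_2\otimes b_2)$, $\mathcal R(a\otimes bc)=\mathcal R(a_1\otimes c)\mathcal R(a_2\otimes b)$ and $\mathcal R(ab\otimes c)=\mathcal R(a\otimes c_1)\mathcal R(b\otimes c_2)$. An infinitesimal $\mathcal R$-form on $(H,\mathcal R)$ is a linear map $\chi\colon H\otimes H\to\Bbbk$ such that, for all $a,b,c\in H$, $$\chi(a_1\otimes b_1)a_2b_2=a_1b_1\chi(a_2\otimes b_2),$$ $$\chi(a\otimes bc)=\chi(a\otimes b)\varepsilon(c)+\mathcal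 R^{-1}(a_1\otimes b_1)\chi(a_2\otimes c)\mathcal R(a_3\otimes b_2),$$ $$\chi(ab\otimes c)=\varepsilon(a)\chi(b\otimes c)+\mathcal R^{-1}(b_1\otimes c_1)\chi(a\otimes c_2)\mathcal R(b_2\otimes c_3).$$ Then there is a unique coquasitriangular structure $\mathcal R$ on $A(c)$ with $\mathcal R(T_i^k\otimes T_j^\ell)=c_{ji}^{k\ell}$ for all $i,j,k,\ell$ (the FRT structure); it descends to a coquasitriangular structure, again denoted $\mathcal R$, on the quotient $A(c,t)$; and there is a unique infinitesimal $\mathcal R$-form $\chi$ on $(A(c,t),\mathcal R)$ such that $\chi(T_i^k\otimes T_j^\ell)=t_{ij}^{k\ell}$ for all $i,j,k,\ell$. -/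

import Mathlib

open scoped TensorProduct
open WithConv

noncomputable section

namespace InfFRT

/-! ### Coquasitriangular bialgebras and infinitesimal `R`-forms -/

section Forms

variable {k H : Type*} [Field k] [Ring H] [Bialgebra k H]

/-- The convolution algebra `Hom(H ⊗ H, k)` of bilinear forms on `H`. -/
abbrev ConvForm (k H : Type*) [Field k] [Ring H] [Bialgebra k H] : Type _ :=
  WithConv (H ⊗[k] H →ₗ[k] k)

/-- `f₁₂ = f ⊗ ε`, i.e. `f₁₂(a ⊗ b ⊗ c) = f(a ⊗ b) ε(c)`. -/
def form12 (f : ConvForm k H) : WithConv ((H ⊗[k] H) ⊗[k] H →ₗ[k] k) :=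
  toConv (LinearMap.mul' k k ∘ₗ TensorProduct.map f.ofConv Coalgebra.counit)

/-- `f₂₃ = ε ⊗ f`, i.e. `f₂₃(a ⊗ b ⊗ c) = ε(a) f(b ⊗ c)`. -/
def form23 (f : ConvForm k H) : WithConv ((H ⊗[k] H) ⊗[k] H →ₗ[k] k) :=
  toConv (LinearMap.mul' k k ∘ₗ TensorProduct.map Coalgebra.counit f.ofConv ∘ₗ
    (TensorProduct.assoc k H H H).toLinearMap)

/-- `f₁₃ = (ε ⊗ f)(τ ⊗ Id)`, i.e. `f₁₃(a ⊗ b ⊗ c) = ε(b) f(a ⊗ c)`. -/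
def form13 (f : ConvForm k H) : WithConv ((H ⊗[k] H) ⊗[k] H →ₗ[k] k) :=
  toConv ((form23 f).ofConv ∘ₗ
    TensorProduct.map (TensorProduct.comm k H H).toLinearMap LinearMap.id)

/-- `f(Id ⊗ m)`, i.e. `a ⊗ b ⊗ c ↦ f(a ⊗ bc)`. -/
def formMulRight (f : ConvForm k H) : WithConv ((H ⊗[k] H) ⊗[k] H →ₗ[k] k) :=
  toConv (f.ofConv ∘ₗ TensorProduct.map LinearMap.id (LinearMap.mul' k H) ∘ₗ
    (TensorProduct.assoc k H H H).toLinearMap)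

/-- `f(m ⊗ Id)`, i.e. `a ⊗ b ⊗ c ↦ f(ab ⊗ c)`. -/
def formMulLeft (f : ConvForm k H) : WithConv ((H ⊗[k] H) ⊗[k] H →ₗ[k] k) :=
  toConv (f.ofConv ∘ₗ TensorProduct.map (LinearMap.mul' k H) LinearMap.id)

/-- The form `f` composed with the unit of `H`, as an element of the convolution algebra
`Hom(H ⊗ H, H)`. -/
def unitForm (f : ConvForm k H) : WithConv (H ⊗[k] H →ₗ[k] H) :=
  toConv (Algebra.linearMap k H ∘ₗ f.ofConv)

variable (k H) in
/-- The multiplication of `H`, as an element of the convolution algebra `Hom(H ⊗ H, H)`. -/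
def convMult : WithConv (H ⊗[k] H →ₗ[k] H) := toConv (LinearMap.mul' k H)

variable (k H) in
/-- The opposite multiplication `a ⊗ b ↦ ba`. -/
def convMultOp : WithConv (H ⊗[k] H →ₗ[k] H) :=
  toConv (LinearMap.mul' k H ∘ₗ (TensorProduct.comm k H H).toLinearMap)

/-- A convolution-invertible form `R` is a coquasitriangular structure on `H`. -/
structure IsCoquasitriangular (R : (ConvForm k H)ˣ) : Prop where
  /-- `R(a₁ ⊗ b₁) a₂ b₂ = b₁ a₁ R(a₂ ⊗ b₂)` -/
  quasi_comm : unitForm (R : ConvForm k H) * convMult k H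
    = convMultOp k H * unitForm (R : ConvForm k H)
  /-- `R(a ⊗ bc) = R(a₁ ⊗ c) R(a₂ ⊗ b)` -/
  mul_right : formMulRight (R : ConvForm k H)
    = form13 (R : ConvForm k H) * form12 (R : ConvForm k H)
  /-- `R(ab ⊗ c) = R(a ⊗ c₁) R(b ⊗ c₂)` -/
  mul_left : formMulLeft (R : ConvForm k H)
    = form13 (R : ConvForm k H) * form23 (R : ConvForm k H)

/-- `χ` is an infinitesimal `R`-form on `(H, R)`. -/
structure IsInfinitesimalRForm (R : (ConvForm k H)ˣ) (χ : ConvForm k H) : Prop where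
  /-- `χ(a₁ ⊗ b₁) a₂ b₂ = a₁ b₁ χ(a₂ ⊗ b₂)` -/
  central : unitForm χ * convMult k H = convMult k H * unitForm χ
  /-- `χ(a ⊗ bc) = χ(a ⊗ b) ε(c) + R⁻¹(a₁ ⊗ b₁) χ(a₂ ⊗ c) R(a₃ ⊗ b₂)` -/
  mul_right : formMulRight χ = form12 χ +
    form12 ((R⁻¹ : (ConvForm k H)ˣ) : ConvForm k H) * form13 χ * form12 (R : ConvForm k H)
  /-- `χ(ab ⊗ c) = ε(a) χ(b ⊗ c) + R⁻¹(b₁ ⊗ c₁) χ(a ⊗ c₂) R(b₂ ⊗ c₃)` -/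
  mul_left : formMulLeft χ = form23 χ +
    form23 ((R⁻¹ : (ConvForm k H)ˣ) : ConvForm k H) * form13 χ * form23 (R : ConvForm k H)

end Forms

/-! ### Infinitesimally braided vector spaces -/

section Braided

variable {k V : Type*} [Field k] [AddCommGroup V] [Module k V]

/-- `f₁₂ = f ⊗ Id` on `V ⊗ V ⊗ V`. -/
def leg12 (f : Module.End k (V ⊗[k] V)) : Module.End k ((V ⊗[k] V) ⊗[k] V) :=
  TensorProduct.map f LinearMap.id

/-- `f₂₃ = Id ⊗ f` on `V ⊗ V ⊗ V`. -/
def leg23 (f : Module.End k (V ⊗[k] V)) : Module.End k ((V ⊗[k] V) ⊗[k] V) :=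
  (TensorProduct.assoc k V V V).symm.toLinearMap ∘ₗ TensorProduct.map LinearMap.id f ∘ₗ
    (TensorProduct.assoc k V V V).toLinearMap

/-- `(V, c)` is a braided vector space. -/
def IsBraided (c : (V ⊗[k] V) ≃ₗ[k] (V ⊗[k] V)) : Prop :=
  leg12 c.toLinearMap * leg23 c.toLinearMap * leg12 c.toLinearMap =
    leg23 c.toLinearMap * leg12 c.toLinearMap * leg23 c.toLinearMap

/-- `(V, c, t)` is an infinitesimally braided vector space. -/
structure IsInfinitesimallyBraided (c : (V ⊗[k] V) ≃ₗ[k] (V ⊗[k] V))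
    (t : Module.End k (V ⊗[k] V)) : Prop where
  braid : IsBraided c
  /-- `c₂₃ t₁₂ c₂₃⁻¹ = c₁₂⁻¹ t₂₃ c₁₂` -/
  conj₁ : leg23 c.toLinearMap * leg12 t * leg23 c.symm.toLinearMap =
    leg12 c.symm.toLinearMap * leg23 t * leg12 c.toLinearMap
  /-- `c₁₂⁻¹ t₂₃ c₁₂ = c₂₃⁻¹ t₁₂ c₂₃` -/
  conj₂ : leg12 c.symm.toLinearMap * leg23 t * leg12 c.toLinearMap =
    leg23 c.symm.toLinearMap * leg12 t * leg23 c.toLinearMap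
  /-- `c₂₃⁻¹ t₁₂ c₂₃ = c₁₂ t₂₃ c₁₂⁻¹` -/
  conj₃ : leg23 c.symm.toLinearMap * leg12 t * leg23 c.toLinearMap =
    leg12 c.toLinearMap * leg23 t * leg12 c.symm.toLinearMap
  /-- `t₁₂ t₂₃ + c₁₂ t₂₃ c₁₂⁻¹ t₂₃ = t₂₃ t₁₂ + t₂₃ c₁₂ t₂₃ c₁₂⁻¹` -/
  comm₁ : leg12 t * leg23 t +
      leg12 c.toLinearMap * leg23 t * leg12 c.symm.toLinearMap * leg23 t =
    leg23 t * leg12 t +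
      leg23 t * leg12 c.toLinearMap * leg23 t * leg12 c.symm.toLinearMap
  /-- `t₂₃ t₁₂ + c₂₃ t₁₂ c₂₃⁻¹ t₁₂ = t₁₂ t₂₃ + t₁₂ c₂₃ t₁₂ c₂₃⁻¹` -/
  comm₂ : leg23 t * leg12 t +
      leg23 c.toLinearMap * leg12 t * leg23 c.symm.toLinearMap * leg12 t =
    leg12 t * leg23 t +
      leg12 t * leg23 c.toLinearMap * leg12 t * leg23 c.symm.toLinearMap

/-- The coefficient `f_{ij}^{pq}` of `f` in the basis `b`, where
`f (b i ⊗ b j) = ∑ p q, f_{ij}^{pq} • b p ⊗ b q`. -/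
def coeff {ι : Type*} (b : Module.Basis ι k V) (f : Module.End k (V ⊗[k] V))
    (i j p q : ι) : k :=
  (b.tensorProduct b).repr (f (b i ⊗ₜ[k] b j)) (p, q)

end Braided

/-! ### The free bialgebra on a matrix of indeterminates -/

section Free

variable (k ι : Type*) [Field k]

/-- The free algebra `F` on indeterminates `T_i^j`. -/
def F : Type _ := FreeAlgebra k (ι × ι)

instance : Ring (F k ι) := inferInstanceAs (Ring (FreeAlgebra k (ι × ι)))

instance : Algebra k (F k ι) := inferInstanceAs (Algebra k (FreeAlgebra k (ι × ι)))

variable {ι}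

/-- The indeterminate `T_i^j` of `F`. -/
def genF (i j : ι) : F k ι := FreeAlgebra.ι k (i, j)

variable {k}

/-- The universal property of `F`: the algebra map with `T_i^j ↦ f i j`. -/
def liftF {A : Type*} [Ring A] [Algebra k A] (f : ι → ι → A) : F k ι →ₐ[k] A :=
  FreeAlgebra.lift k (fun p : ι × ι => f p.1 p.2)

@[simp] lemma liftF_genF {A : Type*} [Ring A] [Algebra k A] (f : ι → ι → A) (i j : ι) :
    liftF f (genF k i j) = f i j :=
  FreeAlgebra.lift_ι_apply _ _

lemma algHomF_ext {A : Type*} [Ring A] [Algebra k A] {f g : F k ι →ₐ[k] A}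
    (h : ∀ i j, f (genF k i j) = g (genF k i j)) : f = g :=
  FreeAlgebra.hom_ext (funext fun p => h p.1 p.2)

variable [Fintype ι] [DecidableEq ι]

/-- `Δ(T_i^j) = ∑ p, T_i^p ⊗ T_p^j` and `ε(T_i^j) = δ_i^j`, extended as algebra maps. -/
instance : Bialgebra k (F k ι) :=
  Bialgebra.ofAlgHom
    (liftF fun i j => ∑ p, genF k i p ⊗ₜ[k] genF k p j)
    (liftF fun i j => if i = j then 1 else 0)
    (by
      apply algHomF_ext
      intro i j
      simp [TensorProduct.sum_tmul, TensorProduct.tmul_sum]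
      rw [Finset.sum_comm])
    (by
      apply algHomF_ext
      intro i j
      simp [TensorProduct.ite_tmul])
    (by
      apply algHomF_ext
      intro i j
      simp [TensorProduct.tmul_ite])

lemma comul_genF (i j : ι) :
    Coalgebra.comul (R := k) (genF k i j) = ∑ p, genF k i p ⊗ₜ[k] genF k p j :=
  liftF_genF _ i j

lemma counit_genF (i j : ι) :
    Coalgebra.counit (R := k) (genF k i j) = if i = j then 1 else 0 :=
  liftF_genF _ i j

end Free

/-! ### The quotient bialgebras `A(c)` and `A(c,t)` -/

section Rel

variable {k ι H : Type*} [Field k] [Fintype ι] [Ring H]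

/-- `∑ m n, s_{ij}^{mn} T_m^p T_n^q - ∑ m n, T_i^m T_j^n s_{mn}^{pq}`. -/
def rel [Algebra k H] (s : ι → ι → ι → ι → k) (T : ι → ι → H) (i j p q : ι) : H :=
  (∑ m, ∑ n, s i j m n • (T m p * T n q)) - ∑ m, ∑ n, s m n p q • (T i m * T j n)

/-- The two-sided ideal generated by all `rel s T i j p q`. -/
def relIdeal [Algebra k H] (s : ι → ι → ι → ι → k) (T : ι → ι → H) : Ideal H :=
  (TwoSidedIdeal.span {x : H | ∃ i j p q, x = rel s T i j p q}).asIdeal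

instance [Algebra k H] (s : ι → ι → ι → ι → k) (T : ι → ι → H) :
    (relIdeal s T).IsTwoSided :=
  inferInstanceAs (TwoSidedIdeal.asIdeal _).IsTwoSided

lemma relIdeal_le_ker [Algebra k H] (s : ι → ι → ι → ι → k) (T : ι → ι → H)
    {B : Type*} [Ring B] [Algebra k B] (φ : H →ₐ[k] B)
    (h : ∀ i j p q, φ (rel s T i j p q) = 0) {x : H} (hx : x ∈ relIdeal s T) : φ x = 0 := by
  have hle : TwoSidedIdeal.span {x : H | ∃ i j p q, x = rel s T i j p q} ≤
      TwoSidedIdeal.ker φ := by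
    rw [TwoSidedIdeal.span_le]
    rintro _ ⟨i, j, p, q, rfl⟩
    exact (TwoSidedIdeal.mem_ker φ).2 (h i j p q)
  exact (TwoSidedIdeal.mem_ker φ).1 (hle (TwoSidedIdeal.mem_asIdeal.1 hx))

lemma rel_mem [Algebra k H] (s : ι → ι → ι → ι → k) (T : ι → ι → H) (i j p q : ι) :
    rel s T i j p q ∈ relIdeal s T :=
  TwoSidedIdeal.mem_asIdeal.2 (TwoSidedIdeal.subset_span ⟨i, j, p, q, rfl⟩)

lemma map_rel [Algebra k H] (s : ι → ι → ι → ι → k) (T : ι → ι → H)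
    {B : Type*} [Ring B] [Algebra k B] (φ : H →ₐ[k] B) (i j p q : ι) :
    φ (rel s T i j p q) = rel s (fun i j => φ (T i j)) i j p q := by
  simp [rel]

/-- `Δ(D_{ij}^{pq}) = D_{ij}^{mn} ⊗ T_m^p T_n^q + T_i^m T_j^n ⊗ D_{mn}^{pq}`. -/
lemma rel_tensor {A B : Type*} [Ring A] [Algebra k A] [Ring B] [Algebra k B]
    (s : ι → ι → ι → ι → k) (T : ι → ι → A) (U : ι → ι → B) (i j p q : ι) :
    rel s (fun i j => ∑ r, T i r ⊗ₜ[k] U r j) i j p q =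
      (∑ m, ∑ n, rel s T i j m n ⊗ₜ[k] (U m p * U n q)) +
        ∑ m, ∑ n, (T i m * T j n) ⊗ₜ[k] rel s U m n p q := by
  have sw : ∀ {M : Type _} [AddCommGroup M] (f : ι → ι → ι → ι → M),
      ∑ a, ∑ b, ∑ c, ∑ d, f a b c d = ∑ c, ∑ d, ∑ a, ∑ b, f a b c d := by
    intro M _ f
    simp_rw [← Fintype.sum_prod_type' (f := fun c d => f _ _ c d)]
    simp_rw [← Fintype.sum_prod_type' (f := fun a b => ∑ x : ι × ι, f a b x.1 x.2)]
    rw [Finset.sum_comm]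
    simp_rw [Fintype.sum_prod_type]
  simp only [rel, TensorProduct.sub_tmul, TensorProduct.tmul_sub, TensorProduct.sum_tmul,
    TensorProduct.tmul_sum, Finset.sum_sub_distrib, TensorProduct.smul_tmul',
    TensorProduct.tmul_smul, Finset.sum_mul_sum, Algebra.TensorProduct.tmul_mul_tmul,
    Finset.smul_sum]
  rw [sw fun m n r r' => (s i j m n • (T m r * T n r')) ⊗ₜ[k] (U r p * U r' q),
    sw fun m n r r' => (s m n p q • (T i r * T j r')) ⊗ₜ[k] (U r m * U r' n),
    sw fun m n r r' => (s r r' m n • (T i r * T j r')) ⊗ₜ[k] (U m p * U n q)]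
  abel

lemma relIdeal_isCoideal [DecidableEq ι] [Bialgebra k H]
    (s : ι → ι → ι → ι → k) (T : ι → ι → H)
    (hΔ : ∀ i j, Coalgebra.comul (R := k) (T i j) = ∑ p, T i p ⊗ₜ[k] T p j)
    (hε : ∀ i j, Coalgebra.counit (R := k) (T i j) = if i = j then 1 else 0) :
    ((relIdeal s T).restrictScalars k).IsCoideal where
  counit_eq_zero x hx := by
    refine relIdeal_le_ker s T (Bialgebra.counitAlgHom k H) (fun i j p q => ?_) hx
    simp [rel, hε]
  map_mkQ_comul_eq_zero x hx := by
    let π := Ideal.Quotient.mkₐ k (relIdeal s T)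
    refine relIdeal_le_ker s T ((Algebra.TensorProduct.map π π).comp
      (Bialgebra.comulAlgHom k H)) (fun i j p q => ?_) hx
    have h0 : ∀ i j p q, rel s (fun i j => π (T i j)) i j p q = 0 := fun i j p q => by
      rw [← map_rel]
      exact Ideal.Quotient.eq_zero_iff_mem.2 (rel_mem s T i j p q)
    rw [map_rel]
    simp only [AlgHom.comp_apply, Bialgebra.comulAlgHom_apply, hΔ, map_sum,
      Algebra.TensorProduct.map_tmul]
    rw [rel_tensor]
    simp [h0]

end Rel

section FRT

variable {k V ι : Type*} [Field k] [AddCommGroup V] [Module k V] [Fintype ι] [DecidableEq ι]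
  (b : Module.Basis ι k V) (c t : Module.End k (V ⊗[k] V))

instance : ((relIdeal (coeff b c) (genF k)).restrictScalars k).IsCoideal :=
  relIdeal_isCoideal _ _ comul_genF counit_genF

/-- The bialgebra `A(c) = F / I(c)`, where `I(c)` is the two-sided ideal generated by the elements
`c_{ij}^{mn} T_m^p T_n^q - T_i^m T_j^n c_{mn}^{pq}`. -/
abbrev FRTBialgebra : Type _ := F k ι ⧸ relIdeal (coeff b c) (genF k)

/-- The class of `T_i^j` in `A(c)`. -/
def genFRT (i j : ι) : FRTBialgebra b c := Ideal.Quotient.mk _ (genF k i j)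

lemma comul_genFRT (i j : ι) :
    Coalgebra.comul (R := k) (genFRT b c i j) = ∑ p, genFRT b c i p ⊗ₜ[k] genFRT b c p j := by
  simp [genFRT, comul_genF]

lemma counit_genFRT (i j : ι) :
    Coalgebra.counit (R := k) (genFRT b c i j) = if i = j then 1 else 0 := by
  simp [genFRT, counit_genF]

instance : ((relIdeal (coeff b t) (genFRT b c)).restrictScalars k).IsCoideal :=
  relIdeal_isCoideal _ _ (comul_genFRT b c) (counit_genFRT b c)

/-- The bialgebra `A(c,t) = A(c) / I(t)`, where `I(t)` is the two-sided ideal generated by the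
elements `t_{ij}^{mn} T_m^p T_n^q - T_i^m T_j^n t_{mn}^{pq}`. -/
abbrev InfFRTBialgebra : Type _ := FRTBialgebra b c ⧸ relIdeal (coeff b t) (genFRT b c)

/-- The canonical projection `A(c) → A(c,t)`. -/
def proj : FRTBialgebra b c →ₐc[k] InfFRTBialgebra b c t :=
  Bialgebra.Quotient.mkBialgHom (relIdeal (coeff b t) (genFRT b c))

/-- The class of `T_i^j` in `A(c,t)`. -/
def genInfFRT (i j : ι) : InfFRTBialgebra b c t := proj b c t (genFRT b c i j)

/-- `R` is the FRT coquasitriangular structure on `A(c)`: it is coquasitriangular and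
`R(T_i^p ⊗ T_j^q) = c_{ji}^{pq}` on generators. -/
structure IsFRTStructure (R : (ConvForm k (FRTBialgebra b c))ˣ) : Prop where
  coquasitriangular : IsCoquasitriangular R
  gen : ∀ i j p q : ι,
    R.val.ofConv (genFRT b c i p ⊗ₜ[k] genFRT b c j q) = coeff b c j i p q

/-- `R' : A(c,t) ⊗ A(c,t) → k` is induced by `R : A(c) ⊗ A(c) → k` on the quotient. -/
def Descends (R : (ConvForm k (FRTBialgebra b c))ˣ)
    (R' : (ConvForm k (InfFRTBialgebra b c t))ˣ) : Prop :=
  ∀ x y : FRTBialgebra b c,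
    R'.val.ofConv (proj b c t x ⊗ₜ[k] proj b c t y) = R.val.ofConv (x ⊗ₜ[k] y)

end FRT

end InfFRT

end

/-! An infinitesimal `R`-form is a first order deformation of `R`. Over the dual numbers put `f =
R(1 + εχ) = R + ε(R * χ)`, a convolution product. Multiplied on the left by `R₁₃R₂₃` and `R₁₃R₁₂`,
the two product rules for `χ` become Leibniz rules for `R * χ`; together with the product rules of
`R` they say that `f` is a bicharacter, multiplicative in the first and antimultiplicative in the
second argument (`formMulLeft_mul_iff`, `formMulRight_mul_iff`). Quasi-commutativity of `f` and of
`R` gives the centrality of `χ`. The theorem thus reduces to bicharacters with values in a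
commutative algebra `K`: `K = k` yields `R`, `K = k[ε]` yields `f`, and `χ = R⁻¹ * sndForm f`.

Uniqueness holds because a bicharacter is determined by its values on generators
(`IsPresentation.bicharacter_ext`). Descent to `A(c,t)` follows from the same uniqueness: the form
built directly on `A(c,t)` pulls back to the FRT structure on `A(c)`.

For existence, a matrix `M` of values on generators is extended one argument at a time: to an
antimultiplicative matrix representation `b ↦ R(T_i^p ⊗ b)`, then to an algebra map from `H` to its
convolution dual (`IsPresentation.exists_bicharacter`). No antipode is needed for invertibility,
since the inverse of a matrix solution of the relations solves the opposite relations. The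
extensions exist if, up to a swap of rows, `S₁₂M₂₃M₁₂ = M₂₃M₁₂S₂₃` and `S₂₃M₁₂M₂₃ = M₁₂M₂₃S₁₂` for
every relation matrix `S`.

These identities are checked for `M = C(1 + eT)` with `e² = 0` and `S = C, T`. To first order
`M₂₃M₁₂ = C₂₃C₁₂(1 + eΩ)` with `Ω = T₁₂ + C₁₂⁻¹T₂₃C₁₂`, so beyond the undeformed identities it
suffices that `Ω` commutes with `C₂₃` and `T₂₃`. The first holds because conjugation by `C₂₃`
exchanges the summands of `Ω`, the second is a commutator axiom. -/

noncomputable section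

namespace InfFRT

open Coalgebra

/-! ### Functoriality of convolution algebras -/

section Convolution

variable {k A B C D : Type*} [Field k] [Ring A] [Algebra k A] [Ring B] [Algebra k B]
  [AddCommGroup C] [Module k C] [Coalgebra k C] [AddCommGroup D] [Module k D] [Coalgebra k D]

/-- Precomposition with a coalgebra map, as a map of convolution algebras. -/
def pull (φ : C →ₗc[k] D) : WithConv (D →ₗ[k] A) →ₐ[k] WithConv (C →ₗ[k] A) :=
  AlgHom.ofLinearMap
    { toFun := fun f => toConv (f.ofConv ∘ₗ φ.toLinearMap)
      map_add' := fun _ _ => rfl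
      map_smul' := fun _ _ => rfl }
    (by
      ext x
      simp)
    (fun f g => congrArg toConv (LinearMap.convMul_comp_coalgHom_distrib f g φ))

@[simp] lemma pull_apply (φ : C →ₗc[k] D) (f : WithConv (D →ₗ[k] A)) (x : C) :
    (pull φ f).ofConv x = f.ofConv (φ x) := rfl

/-- Postcomposition with an algebra map, as a map of convolution algebras. -/
def push (φ : A →ₐ[k] B) : WithConv (C →ₗ[k] A) →ₐ[k] WithConv (C →ₗ[k] B) :=
  AlgHom.ofLinearMap
    { toFun := fun f => toConv (φ.toLinearMap ∘ₗ f.ofConv)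
      map_add' := fun f g => by ext x; simp
      map_smul' := fun f g => by ext x; simp }
    (by
      ext x
      simp)
    (fun f g => congrArg toConv (LinearMap.algHom_comp_convMul_distrib φ f g))

@[simp] lemma push_apply (φ : A →ₐ[k] B) (f : WithConv (C →ₗ[k] A)) (x : C) :
    (push φ f).ofConv x = φ (f.ofConv x) := rfl

lemma sum_counit_mul_right {M : Type*} [AddCommGroup M] [Module k M] {κ : Type*} {a : C}
    (r : Repr k a κ) (f : C →ₗ[k] M) :
    ∑ i ∈ r.index, counit (R := k) (r.left i) • f (r.right i) = f a := by
  simp_rw [← map_smul, ← map_sum, sum_counit_smul]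

lemma sum_counit_mul_left {M : Type*} [AddCommGroup M] [Module k M] {κ : Type*} {a : C}
    (r : Repr k a κ) (f : C →ₗ[k] M) :
    ∑ i ∈ r.index, counit (R := k) (r.right i) • f (r.left i) = f a := by
  simp_rw [← map_smul, ← map_sum]
  congr 1
  have h := congrArg (TensorProduct.rid k C) (sum_tmul_counit_eq r)
  rwa [map_sum, TensorProduct.rid_tmul, one_smul] at h

end Convolution

/-! ### Forms with values in a commutative algebra -/

section Bicharacter

variable {k H K : Type*} [Field k] [Ring H] [Bialgebra k H] [CommRing K] [Algebra k K]

/-- `a ↦ f(a ⊗ -)`. -/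
def legL (f : WithConv (H ⊗[k] H →ₗ[k] K)) : H →ₗ[k] WithConv (H →ₗ[k] K) :=
  (WithConv.linearEquiv k _).symm.toLinearMap ∘ₗ TensorProduct.curry f.ofConv

/-- `b ↦ f(- ⊗ b)`. -/
def legR (f : WithConv (H ⊗[k] H →ₗ[k] K)) : H →ₗ[k] WithConv (H →ₗ[k] K) :=
  (WithConv.linearEquiv k _).symm.toLinearMap ∘ₗ (TensorProduct.curry f.ofConv).flip

@[simp] lemma legL_apply (f : WithConv (H ⊗[k] H →ₗ[k] K)) (a b : H) :
    (legL f a).ofConv b = f.ofConv (a ⊗ₜ b) := rfl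

@[simp] lemma legR_apply (f : WithConv (H ⊗[k] H →ₗ[k] K)) (a b : H) :
    (legR f b).ofConv a = f.ofConv (a ⊗ₜ b) := rfl

lemma form_ext {M : Type*} [AddCommGroup M] [Module k M]
    {f g : WithConv (H ⊗[k] H →ₗ[k] M)}
    (h : ∀ a b, f.ofConv (a ⊗ₜ b) = g.ofConv (a ⊗ₜ b)) : f = g := by
  ext a b
  exact h a b

lemma convMul_tmul {A : Type*} [Ring A] [Algebra k A] (f g : WithConv (H ⊗[k] H →ₗ[k] A))
    {κ κ' : Type*} {a b : H} (r : Repr k a κ) (s : Repr k b κ') :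
    (f * g).ofConv (a ⊗ₜ b) = ∑ i ∈ r.index, ∑ j ∈ s.index,
      f.ofConv (r.left i ⊗ₜ s.left j) * g.ofConv (r.right i ⊗ₜ s.right j) := by
  have := (r.tmul s).convMul_apply f g
  simpa [Finset.sum_product] using this

lemma legL_mul (f g : WithConv (H ⊗[k] H →ₗ[k] K)) {κ : Type*} {a : H} (r : Repr k a κ) :
    legL (f * g) a = ∑ i ∈ r.index, legL f (r.left i) * legL g (r.right i) := by
  ext b
  simp [convMul_tmul f g r (ℛ k b), (ℛ k b).convMul_apply, ofConv_sum]

lemma legR_mul (f g : WithConv (H ⊗[k] H →ₗ[k] K)) {κ : Type*} {b : H} (r : Repr k b κ) :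
    legR (f * g) b = ∑ i ∈ r.index, legR f (r.left i) * legR g (r.right i) := by
  ext a
  simp only [legR_apply, convMul_tmul f g (ℛ k a) r, (ℛ k a).convMul_apply, ofConv_sum,
    LinearMap.sum_apply]
  rw [Finset.sum_comm]

/-- A form that is multiplicative in the first and antimultiplicative in the second argument. -/
structure IsBicharacter (f : WithConv (H ⊗[k] H →ₗ[k] K)) : Prop where
  mul_left : ∀ a b, legL f (a * b) = legL f a * legL f b
  mul_right : ∀ b c, legR f (b * c) = legR f c * legR f b
  one_left : legL f 1 = 1
  one_right : legR f 1 = 1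

lemma legL_one_form (a : H) :
    legL (1 : WithConv (H ⊗[k] H →ₗ[k] K)) a = algebraMap k _ (counit a) := by
  ext b
  simp [Algebra.smul_def, mul_comm]

lemma legR_one_form (a : H) :
    legR (1 : WithConv (H ⊗[k] H →ₗ[k] K)) a = algebraMap k _ (counit a) := by
  ext b
  simp [Algebra.smul_def]

/-- The trivial presentation `Δ(1) = 1 ⊗ 1`. -/
def reprOne : Repr k (1 : H) Unit where
  index := Finset.univ
  left _ := 1
  right _ := 1
  eq := by simp [Algebra.TensorProduct.one_def]

/-- The value at `1` is idempotent by multiplicativity, and invertible because `1` is grouplike, so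
that `legL f⁻¹ 1` inverts `legL f 1`. An invertible idempotent is `1`. -/
lemma isBicharacter_of_isUnit {f : WithConv (H ⊗[k] H →ₗ[k] K)} (hf : IsUnit f)
    (hl : ∀ a b, legL f (a * b) = legL f a * legL f b)
    (hr : ∀ b c, legR f (b * c) = legR f c * legR f b) : IsBicharacter f := by
  obtain ⟨u, rfl⟩ := hf
  have h1 : legL (u : WithConv (H ⊗[k] H →ₗ[k] K)) 1 * legL ↑u⁻¹ 1 = 1 := by
    have := legL_mul (u : WithConv (H ⊗[k] H →ₗ[k] K)) ↑u⁻¹ (reprOne (k := k) (H := H))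
    simpa [reprOne, legL_one_form] using this.symm
  have h2 : legR (u : WithConv (H ⊗[k] H →ₗ[k] K)) 1 * legR ↑u⁻¹ 1 = 1 := by
    have := legR_mul (u : WithConv (H ⊗[k] H →ₗ[k] K)) ↑u⁻¹ (reprOne (k := k) (H := H))
    simpa [reprOne, legR_one_form] using this.symm
  refine ⟨hl, hr, ?_, ?_⟩
  · have h3 := hl 1 1
    rw [mul_one] at h3
    have := congrArg (· * legL (↑u⁻¹ : WithConv (H ⊗[k] H →ₗ[k] K)) 1) h3
    simpa [mul_assoc, h1] using this.symm
  · have h3 := hr 1 1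
    rw [mul_one] at h3
    have := congrArg (· * legR (↑u⁻¹ : WithConv (H ⊗[k] H →ₗ[k] K)) 1) h3
    simpa [mul_assoc, h2] using this.symm

/-- `f(- ⊗ b)`, as an algebra map in `b` with values in the opposite algebra. -/
def IsBicharacter.right {f : WithConv (H ⊗[k] H →ₗ[k] K)} (hf : IsBicharacter f) :
    H →ₐ[k] (WithConv (H →ₗ[k] K))ᵐᵒᵖ :=
  AlgHom.ofLinearMap ((MulOpposite.opLinearEquiv k).toLinearMap ∘ₗ legR f)
    (by simp [hf.one_right]) (by simp [hf.mul_right])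

end Bicharacter

/-! ### Forms in three arguments -/

section Legs

variable {k H : Type*} [Field k] [Ring H] [Bialgebra k H]

variable (k H) in
/-- `a ⊗ b ⊗ c ↦ a ⊗ bc` -/
def mulRightHom : (H ⊗[k] H) ⊗[k] H →ₗc[k] H ⊗[k] H :=
  (Coalgebra.TensorProduct.map (.id k H) (Bialgebra.mulCoalgHom k H)).comp
    (Coalgebra.TensorProduct.assoc k k H H H).toCoalgHom

variable (k H) in
/-- `a ⊗ b ⊗ c ↦ ab ⊗ c` -/
def mulLeftHom : (H ⊗[k] H) ⊗[k] H →ₗc[k] H ⊗[k] H :=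
  Coalgebra.TensorProduct.map (Bialgebra.mulCoalgHom k H) (.id k H)

variable (k H) in
/-- `a ⊗ b ⊗ c ↦ ε(c) a ⊗ b` -/
def hom12 : (H ⊗[k] H) ⊗[k] H →ₗc[k] H ⊗[k] H :=
  (Coalgebra.TensorProduct.rid k k (H ⊗[k] H)).toCoalgHom.comp
    (Coalgebra.TensorProduct.map (.id k (H ⊗[k] H)) (Coalgebra.counitCoalgHom k H))

variable (k H) in
/-- `a ⊗ b ⊗ c ↦ ε(a) b ⊗ c` -/
def hom23 : (H ⊗[k] H) ⊗[k] H →ₗc[k] H ⊗[k] H :=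
  ((Coalgebra.TensorProduct.lid k (H ⊗[k] H)).toCoalgHom.comp
    (Coalgebra.TensorProduct.map (Coalgebra.counitCoalgHom k H) (.id k (H ⊗[k] H)))).comp
    (Coalgebra.TensorProduct.assoc k k H H H).toCoalgHom

variable (k H) in
/-- `a ⊗ b ⊗ c ↦ ε(b) a ⊗ c` -/
def hom13 : (H ⊗[k] H) ⊗[k] H →ₗc[k] H ⊗[k] H :=
  (hom23 k H).comp (Coalgebra.TensorProduct.map
    ((Bialgebra.TensorProduct.comm k H H : H ⊗[k] H →ₐc[k] H ⊗[k] H) :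
      H ⊗[k] H →ₗc[k] H ⊗[k] H) (.id k H))

lemma form_ext₃ {f g : WithConv ((H ⊗[k] H) ⊗[k] H →ₗ[k] k)}
    (h : ∀ a b c, f.ofConv (a ⊗ₜ b ⊗ₜ c) = g.ofConv (a ⊗ₜ b ⊗ₜ c)) : f = g := by
  ext a b c
  exact h a b c

lemma form12_eq_pull (f : ConvForm k H) : form12 f = pull (hom12 k H) f :=
  form_ext₃ fun a b c => by simp [form12, hom12, mul_comm]

lemma form23_eq_pull (f : ConvForm k H) : form23 f = pull (hom23 k H) f :=
  form_ext₃ fun a b c => by simp [form23, hom23]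

lemma form13_eq_pull (f : ConvForm k H) : form13 f = pull (hom13 k H) f :=
  form_ext₃ fun a b c => by
    simp only [form13, form23_eq_pull, hom13]
    rfl

lemma formMulRight_eq_pull (f : ConvForm k H) : formMulRight f = pull (mulRightHom k H) f :=
  form_ext₃ fun a b c => by simp [formMulRight, mulRightHom]

lemma formMulLeft_eq_pull (f : ConvForm k H) : formMulLeft f = pull (mulLeftHom k H) f :=
  form_ext₃ fun a b c => by simp [formMulLeft, mulLeftHom]

/-- The counits in the unused legs absorb the coproducts of `a` and `b`; only that of `c` survives.
This turns identities between three-argument forms into identities in the convolution dual of `H`.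
-/
lemma form13_mul_form23_apply (f g : ConvForm k H) (a b c : H) :
    (form13 f * form23 g).ofConv (a ⊗ₜ b ⊗ₜ c) = (legL f a * legL g b).ofConv c := by
  have := (((ℛ k a).tmul (ℛ k b)).tmul (ℛ k c)).convMul_apply (form13 f) (form23 g)
  rw [this, (ℛ k c).convMul_apply]
  simp only [Coalgebra.Repr.tmul_index, Finset.sum_product_right, Coalgebra.Repr.tmul_left,
    Coalgebra.Repr.tmul_right]
  refine Finset.sum_congr rfl fun l _ => ?_
  simp only [legL_apply]
  have h1 := sum_counit_mul_left (ℛ k a) (legR f ((ℛ k c).left l)).ofConv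
  have h2 := sum_counit_mul_right (ℛ k b) (legR g ((ℛ k c).right l)).ofConv
  simp only [legR_apply] at h1 h2
  rw [← h1, ← h2, Finset.sum_mul_sum, Finset.sum_comm]
  refine Finset.sum_congr rfl fun i _ => Finset.sum_congr rfl fun j _ => ?_
  simp [form13, form23]
  ring

lemma form13_mul_form12_apply (f g : ConvForm k H) (a b c : H) :
    (form13 f * form12 g).ofConv (a ⊗ₜ b ⊗ₜ c) = (legR f c * legR g b).ofConv a := by
  have := (((ℛ k a).tmul (ℛ k b)).tmul (ℛ k c)).convMul_apply (form13 f) (form12 g)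
  rw [this, (ℛ k a).convMul_apply]
  simp only [Coalgebra.Repr.tmul_index, Finset.sum_product, Coalgebra.Repr.tmul_left,
    Coalgebra.Repr.tmul_right]
  refine Finset.sum_congr rfl fun l _ => ?_
  simp only [legR_apply]
  have h1 := sum_counit_mul_left (ℛ k c) (legL f ((ℛ k a).left l)).ofConv
  have h2 := sum_counit_mul_right (ℛ k b) (legL g ((ℛ k a).right l)).ofConv
  simp only [legL_apply] at h1 h2
  rw [← h1, ← h2, Finset.sum_mul_sum, Finset.sum_comm]
  refine Finset.sum_congr rfl fun i _ => Finset.sum_congr rfl fun j _ => ?_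
  simp [form13, form23, form12]
  ring

lemma formMulLeft_apply (f : ConvForm k H) (a b c : H) :
    (formMulLeft f).ofConv (a ⊗ₜ b ⊗ₜ c) = (legL f (a * b)).ofConv c := rfl

lemma formMulRight_apply (f : ConvForm k H) (a b c : H) :
    (formMulRight f).ofConv (a ⊗ₜ b ⊗ₜ c) = (legR f (b * c)).ofConv a := rfl

lemma formMulLeft_eq_iff (f : ConvForm k H) :
    formMulLeft f = form13 f * form23 f ↔ ∀ a b, legL f (a * b) = legL f a * legL f b := by
  refine ⟨fun h a b => ?_, fun h => form_ext₃ fun a b c => ?_⟩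
  · ext c
    rw [← form13_mul_form23_apply, ← h, formMulLeft_apply]
  · rw [form13_mul_form23_apply, ← h, formMulLeft_apply]

lemma formMulRight_eq_iff (f : ConvForm k H) :
    formMulRight f = form13 f * form12 f ↔ ∀ b c, legR f (b * c) = legR f c * legR f b := by
  refine ⟨fun h b c => ?_, fun h => form_ext₃ fun a b c => ?_⟩
  · ext a
    rw [← form13_mul_form12_apply, ← h, formMulRight_apply]
  · rw [form13_mul_form12_apply, ← h, formMulRight_apply]

lemma IsCoquasitriangular.isBicharacter {R : (ConvForm k H)ˣ} (hR : IsCoquasitriangular R) :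
    IsBicharacter (R : ConvForm k H) :=
  isBicharacter_of_isUnit R.isUnit ((formMulLeft_eq_iff _).1 hR.mul_left)
    ((formMulRight_eq_iff _).1 hR.mul_right)

end Legs

/-! ### Products of commuting algebra maps in the convolution algebra -/

section ConvHom

variable {k H Q : Type*} [Field k] [Ring H] [Bialgebra k H] [Ring Q] [Algebra k Q]

/-- The convolution product of two algebra maps with commuting values is an algebra map. -/
def convHom (f g : H →ₐ[k] Q) (h : ∀ x y, Commute (f x) (g y)) : H →ₐ[k] Q :=
  (Algebra.TensorProduct.lift f g h).comp (Bialgebra.comulAlgHom k H)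

lemma convHom_apply (f g : H →ₐ[k] Q) (h : ∀ x y, Commute (f x) (g y)) {κ : Type*} {x : H}
    (r : Repr k x κ) : convHom f g h x = ∑ i ∈ r.index, f (r.left i) * g (r.right i) := by
  simp [convHom, ← r.eq]

end ConvHom

lemma exists_algHom_of_surjective {k A B C : Type*} [Field k] [Ring A] [Algebra k A] [Ring B]
    [Algebra k B] [Ring C] [Algebra k C] (f : A →ₐ[k] B) (hf : Function.Surjective f)
    (g : A →ₐ[k] C) (h : ∀ x, f x = 0 → g x = 0) : ∃ φ : B →ₐ[k] C, ∀ x, φ (f x) = g x := by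
  have key : ∀ x y, f x = f y → g x = g y := fun x y hxy => by
    rw [← sub_eq_zero, ← map_sub]
    exact h _ (by rw [map_sub, hxy, sub_self])
  choose σ hσ using hf
  refine ⟨AlgHom.ofLinearMap
    { toFun := fun b => g (σ b)
      map_add' := fun x y => by rw [← map_add]; exact key _ _ (by simp [hσ])
      map_smul' := fun r x => by
        rw [RingHom.id_apply, ← map_smul]; exact key _ _ (by simp [hσ]) } ?_ fun x y => ?_,
    fun x => key _ _ (hσ _)⟩
  · exact (key _ 1 (by simp [hσ])).trans (map_one g)
  · exact (key _ (σ x * σ y) (by simp [hσ])).trans (map_mul g _ _)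

/-! ### Bialgebras presented by a matrix of generators and quadratic relations -/

section Presentation

variable {k ι H : Type*} [Field k] [Fintype ι] [DecidableEq ι] [Ring H] [Bialgebra k H]

/-- `H` is the bialgebra generated by the entries of the matrix coalgebra `T`, subject to the
relations `rel s T = 0` for `s ∈ S`. -/
structure IsPresentation (S : Set (ι → ι → ι → ι → k)) (T : ι → ι → H) : Prop where
  comul : ∀ i j, Coalgebra.comul (R := k) (T i j) = ∑ p, T i p ⊗ₜ[k] T p j
  counit : ∀ i j, Coalgebra.counit (R := k) (T i j) = if i = j then 1 else 0
  surjective : Function.Surjective (liftF (k := k) T)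
  rel_eq_zero : ∀ s ∈ S, ∀ i j p q, rel s T i j p q = 0
  ker_le : ∀ x, liftF (k := k) T x = 0 → x ∈ TwoSidedIdeal.span
    {x : F k ι | ∃ s ∈ S, ∃ i j p q, x = rel s (genF k) i j p q}

variable {S : Set (ι → ι → ι → ι → k)} {T : ι → ι → H}

/-- The presentation of `Δ(T_i^j)`. -/
def IsPresentation.repr (hT : IsPresentation S T) (i j : ι) : Repr k (T i j) ι where
  index := Finset.univ
  left p := T i p
  right p := T p j
  eq := (hT.comul i j).symm

lemma IsPresentation.induction (hT : IsPresentation S T) {P : H → Prop}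
    (algebraMap : ∀ r : k, P (algebraMap k H r)) (gen : ∀ i j, P (T i j))
    (mul : ∀ a b, P a → P b → P (a * b)) (add : ∀ a b, P a → P b → P (a + b)) (x : H) : P x := by
  obtain ⟨y, rfl⟩ := hT.surjective x
  refine FreeAlgebra.induction k (ι × ι) (motive := fun y => P (liftF T y)) (fun r => ?_)
    (fun p => ?_) (fun a b ha hb => ?_) (fun a b ha hb => ?_) y
  · exact (AlgHom.commutes (liftF (k := k) T) r).symm ▸ algebraMap r
  · exact (liftF_genF (k := k) T p.1 p.2).symm ▸ gen p.1 p.2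
  · exact (map_mul (liftF (k := k) T) a b).symm ▸ mul _ _ ha hb
  · exact (map_add (liftF (k := k) T) a b).symm ▸ add _ _ ha hb

lemma IsPresentation.algHom_ext (hT : IsPresentation S T) {B : Type*} [Ring B] [Algebra k B]
    {f g : H →ₐ[k] B} (h : ∀ i j, f (T i j) = g (T i j)) : f = g := by
  ext x
  induction x using hT.induction with
  | algebraMap r => simp
  | gen i j => exact h i j
  | mul a b ha hb => simp [ha, hb]
  | add a b ha hb => simp [ha, hb]

lemma IsPresentation.exists_lift (hT : IsPresentation S T) {B : Type*} [Ring B] [Algebra k B]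
    (X : ι → ι → B) (hX : ∀ s ∈ S, ∀ i j p q, rel s X i j p q = 0) :
    ∃ φ : H →ₐ[k] B, ∀ i j, φ (T i j) = X i j := by
  have hker : ∀ x, liftF (k := k) T x = 0 → liftF (k := k) X x = 0 := by
    intro x hx
    have hle : TwoSidedIdeal.span
        {x : F k ι | ∃ s ∈ S, ∃ i j p q, x = rel s (genF k) i j p q} ≤
        TwoSidedIdeal.ker (liftF (k := k) X) := by
      rw [TwoSidedIdeal.span_le]
      rintro _ ⟨s, hs, i, j, p, q, rfl⟩
      refine (TwoSidedIdeal.mem_ker _).2 ?_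
      rw [map_rel]
      simpa using hX s hs i j p q
    exact (TwoSidedIdeal.mem_ker _).1 (hle (hT.ker_le x hx))
  obtain ⟨φ, hφ⟩ := exists_algHom_of_surjective (liftF (k := k) T) hT.surjective (liftF X) hker
  exact ⟨φ, fun i j => by simpa using hφ (genF k i j)⟩

/-- An intertwining relation between convolution products only has to be checked on generators. -/
lemma IsPresentation.convHom_intertwine (hT : IsPresentation S T) {Q : Type*} [Ring Q]
    [Algebra k Q] (f g : H →ₐ[k] Q) (h : ∀ x y, Commute (f x) (g y))
    (h' : ∀ x y, Commute (g x) (f y)) (N : Q)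
    (hN : ∀ i j, convHom f g h (T i j) * N = N * convHom g f h' (T i j)) (x : H) :
    convHom f g h x * N = N * convHom g f h' x := by
  induction x using hT.induction with
  | algebraMap r => simpa using Algebra.commutes r N
  | gen i j => exact hN i j
  | mul a b ha hb => rw [map_mul, map_mul, mul_assoc, hb, ← mul_assoc, ha, mul_assoc]
  | add a b ha hb => rw [map_add, map_add, add_mul, mul_add, ha, hb]

/-- The linear map underlying an antimultiplicative map. -/
def unopMap {B : Type*} [Ring B] [Algebra k B] (ψ : H →ₐ[k] Bᵐᵒᵖ) : H →ₗ[k] B :=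
  (MulOpposite.opLinearEquiv k).symm.toLinearMap ∘ₗ ψ.toLinearMap

@[simp] lemma unopMap_apply {B : Type*} [Ring B] [Algebra k B] (ψ : H →ₐ[k] Bᵐᵒᵖ) (x : H) :
    unopMap ψ x = (ψ x).unop := rfl

/-- As for an antipode, the convolution inverse of an algebra map is antimultiplicative: in
`φ(a₁)φ(b₁)ψ(b₂)ψ(a₂)` the inner pair collapses to the central scalar `ε(b)`, then the outer pair to
`ε(a)`. Hence generators suffice. -/
lemma IsPresentation.conv_mul_unop_eq_one (hT : IsPresentation S T) {B : Type*} [Ring B]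
    [Algebra k B] (φ : H →ₐ[k] B) (ψ : H →ₐ[k] Bᵐᵒᵖ)
    (h : ∀ i j, ∑ m, φ (T i m) * (ψ (T m j)).unop = if i = j then 1 else 0) :
    toConv φ.toLinearMap * toConv (unopMap ψ) = 1 := by
  ext x
  induction x using hT.induction with
  | algebraMap r => simp [Algebra.TensorProduct.one_def, Algebra.algebraMap_eq_smul_one]
  | gen i j =>
    rw [(hT.repr i j).convMul_apply]
    simpa [IsPresentation.repr, hT.counit, apply_ite (algebraMap k B)] using h i j
  | mul a b ha hb =>
    rw [((ℛ k a).mul (ℛ k b)).convMul_apply]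
    rw [(ℛ k a).convMul_apply] at ha
    rw [(ℛ k b).convMul_apply] at hb
    simp only [AlgHom.toLinearMap_apply, unopMap_apply, LinearMap.convOne_apply] at ha hb
    simp only [Repr.mul_index, Repr.mul_left, Repr.mul_right, Finset.sum_product,
      AlgHom.toLinearMap_apply, unopMap_apply, map_mul, MulOpposite.unop_mul,
      LinearMap.convOne_apply, Bialgebra.counit_mul]
    rw [← ha, Finset.sum_mul]
    refine Finset.sum_congr rfl fun i _ => ?_
    rw [mul_assoc, ← Algebra.commutes, ← hb, Finset.sum_mul, Finset.mul_sum]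
    simp only [mul_assoc]
  | add a b ha hb => rw [map_add, map_add, ha, hb]

lemma IsPresentation.conv_unop_mul_eq_one (hT : IsPresentation S T) {B : Type*} [Ring B]
    [Algebra k B] (φ : H →ₐ[k] B) (ψ : H →ₐ[k] Bᵐᵒᵖ)
    (h : ∀ i j, ∑ m, (ψ (T i m)).unop * φ (T m j) = if i = j then 1 else 0) :
    toConv (unopMap ψ) * toConv φ.toLinearMap = 1 := by
  ext x
  induction x using hT.induction with
  | algebraMap r => simp [Algebra.TensorProduct.one_def, Algebra.algebraMap_eq_smul_one]
  | gen i j =>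
    rw [(hT.repr i j).convMul_apply]
    simpa [IsPresentation.repr, hT.counit, apply_ite (algebraMap k B)] using h i j
  | mul a b ha hb =>
    rw [((ℛ k a).mul (ℛ k b)).convMul_apply]
    rw [(ℛ k a).convMul_apply] at ha
    rw [(ℛ k b).convMul_apply] at hb
    simp only [AlgHom.toLinearMap_apply, unopMap_apply, LinearMap.convOne_apply] at ha hb
    simp only [Repr.mul_index, Repr.mul_left, Repr.mul_right, Finset.sum_product_right,
      AlgHom.toLinearMap_apply, unopMap_apply, map_mul, MulOpposite.unop_mul,
      LinearMap.convOne_apply, Bialgebra.counit_mul]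
    -- Here the inner pair of `ψ(b₁)ψ(a₁)φ(a₂)φ(b₂)` involves `a`, so the sum over the coproduct of
    -- `b` is taken outside.
    rw [← Algebra.commutes, ← hb, Finset.sum_mul]
    refine Finset.sum_congr rfl fun i _ => ?_
    rw [mul_assoc, ← Algebra.commutes, ← ha, Finset.sum_mul, Finset.mul_sum]
    simp only [mul_assoc]
  | add a b ha hb => rw [map_add, map_add, ha, hb]

end Presentation

/-! ### Inverse matrices satisfy the opposite relations -/

section Inverse

variable {k ι B : Type*} [Field k] [Fintype ι] [Ring B] [Algebra k B]

/-- The tensor `s` as a matrix over `B`. -/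
def relMatrix (B : Type*) [Ring B] [Algebra k B] (s : ι → ι → ι → ι → k) :
    Matrix (ι × ι) (ι × ι) B :=
  .of fun x y => algebraMap k B (s x.1 x.2 y.1 y.2)

/-- Turning the quadratic relations into a commutation of matrices makes them stable under inverses
and products. -/
lemma rel_eq_zero_iff (s : ι → ι → ι → ι → k) (X : ι → ι → B) :
    (∀ i j p q, rel s X i j p q = 0) ↔
      Commute (relMatrix B s) (.of fun x y : ι × ι => X x.1 y.1 * X x.2 y.2) := by
  rw [commute_iff_eq, ← Matrix.ext_iff]
  simp only [rel, sub_eq_zero, Matrix.mul_apply, relMatrix, Matrix.of_apply,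
    Fintype.sum_prod_type, Prod.forall]
  simp only [Algebra.smul_def, Algebra.commutes]

lemma rel_op_eq_zero_iff (s : ι → ι → ι → ι → k) (X : ι → ι → B) :
    (∀ i j p q, rel s (fun i j => MulOpposite.op (X i j)) i j p q = 0) ↔
      Commute (relMatrix B s) (.of fun x y : ι × ι => X x.2 y.2 * X x.1 y.1) := by
  rw [commute_iff_eq, ← Matrix.ext_iff]
  simp only [rel, sub_eq_zero, Matrix.mul_apply, relMatrix, Matrix.of_apply,
    Fintype.sum_prod_type, Prod.forall]
  simp only [← MulOpposite.op_mul, ← MulOpposite.op_smul, ← Finset.op_sum,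
    MulOpposite.op_inj]
  simp only [Algebra.smul_def, Algebra.commutes]

variable [DecidableEq ι]

/-- The order of the factors `Y` is reversed so that the product telescopes from the inside over the
noncommutative ring `B`. -/
lemma mul_pair_eq_one {X Y : ι → ι → B}
    (h : ∀ i j, ∑ m, X i m * Y m j = if i = j then 1 else 0) :
    (.of fun x y : ι × ι => X x.1 y.1 * X x.2 y.2) *
      (.of fun x y : ι × ι => Y x.2 y.2 * Y x.1 y.1 : Matrix (ι × ι) (ι × ι) B) = 1 := by
  ext ⟨i, j⟩ ⟨p, q⟩
  have : ∀ a b : ι, X i a * X j b * (Y b q * Y a p) = X i a * (X j b * Y b q) * Y a p := by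
    intro a b
    simp only [mul_assoc]
  simp only [Matrix.mul_apply, Matrix.of_apply, Fintype.sum_prod_type, this,
    ← Finset.sum_mul, ← Finset.mul_sum, h, mul_ite, mul_one, mul_zero, ite_mul, zero_mul,
    Matrix.one_apply, Prod.mk.injEq]
  by_cases hj : j = q <;> simp [hj, h]

lemma mul_pair_eq_one' {X Y : ι → ι → B}
    (h : ∀ i j, ∑ m, X i m * Y m j = if i = j then 1 else 0) :
    (.of fun x y : ι × ι => X x.2 y.2 * X x.1 y.1) *
      (.of fun x y : ι × ι => Y x.1 y.1 * Y x.2 y.2 : Matrix (ι × ι) (ι × ι) B) = 1 := by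
  ext ⟨i, j⟩ ⟨p, q⟩
  have : ∀ a b : ι, X j b * X i a * (Y a p * Y b q) = X j b * (X i a * Y a p) * Y b q := by
    intro a b
    simp only [mul_assoc]
  simp only [Matrix.mul_apply, Matrix.of_apply, Fintype.sum_prod_type_right, this,
    ← Finset.sum_mul, ← Finset.mul_sum, h, mul_ite, mul_one, mul_zero, ite_mul, zero_mul,
    Matrix.one_apply, Prod.mk.injEq]
  by_cases hj : i = p <;> simp [hj, h]

lemma commute_of_mul_eq_one {M : Type*} [Monoid M] {s x y : M} (h : Commute s x)
    (hxy : x * y = 1) (hyx : y * x = 1) : Commute s y :=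
  Commute.units_inv_right (u := ⟨x, y, hxy, hyx⟩) h

/-- What commutes with an invertible matrix commutes with its inverse, and the inverse of the matrix
of products of entries of `X` has entries multiplied in the opposite order. -/
lemma rel_op_of_inverse {s : ι → ι → ι → ι → k} {X Y : ι → ι → B}
    (hXY : ∀ i j, ∑ m, X i m * Y m j = if i = j then 1 else 0)
    (hYX : ∀ i j, ∑ m, Y i m * X m j = if i = j then 1 else 0)
    (h : ∀ i j p q, rel s X i j p q = 0) (i j p q : ι) :
    rel s (fun i j => MulOpposite.op (Y i j)) i j p q = 0 :=
  (rel_op_eq_zero_iff s Y).2 (commute_of_mul_eq_one ((rel_eq_zero_iff s X).1 h)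
    (mul_pair_eq_one hXY) (mul_pair_eq_one' hYX)) i j p q

lemma rel_of_op_inverse {s : ι → ι → ι → ι → k} {X Y : ι → ι → B}
    (hXY : ∀ i j, ∑ m, X i m * Y m j = if i = j then 1 else 0)
    (hYX : ∀ i j, ∑ m, Y i m * X m j = if i = j then 1 else 0)
    (h : ∀ i j p q, rel s (fun i j => MulOpposite.op (X i j)) i j p q = 0) (i j p q : ι) :
    rel s Y i j p q = 0 :=
  (rel_eq_zero_iff s Y).2 (commute_of_mul_eq_one ((rel_op_eq_zero_iff s X).1 h)
    (mul_pair_eq_one' hXY) (mul_pair_eq_one hYX)) i j p q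

end Inverse

/-! ### Forms from algebra maps into the convolution algebra -/

section OfLegL

variable {k H K : Type*} [Field k] [Ring H] [Bialgebra k H] [CommRing K] [Algebra k K]

/-- The form `a ⊗ b ↦ L(a)(b)`. -/
def ofLegL (L : H →ₗ[k] WithConv (H →ₗ[k] K)) : WithConv (H ⊗[k] H →ₗ[k] K) :=
  toConv (TensorProduct.lift ((WithConv.linearEquiv k _).toLinearMap ∘ₗ L))

@[simp] lemma ofLegL_apply (L : H →ₗ[k] WithConv (H →ₗ[k] K)) (a b : H) :
    (ofLegL L).ofConv (a ⊗ₜ b) = (L a).ofConv b := rfl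

@[simp] lemma legL_ofLegL (L : H →ₗ[k] WithConv (H →ₗ[k] K)) : legL (ofLegL L) = L := rfl

lemma ofLegL_mul_eq_one {L L' : H →ₗ[k] WithConv (H →ₗ[k] K)} (h : toConv L * toConv L' = 1) :
    ofLegL L * ofLegL L' = 1 := by
  refine form_ext fun a b => ?_
  have h1 := congrArg (fun f : WithConv (H →ₗ[k] WithConv (H →ₗ[k] K)) => f.ofConv a) h
  simp only [(ℛ k a).convMul_apply, LinearMap.convOne_apply] at h1
  rw [← legL_apply, ← legL_apply, legL_mul _ _ (ℛ k a), legL_ofLegL, legL_ofLegL, h1,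
    legL_one_form]

variable (k H) in
/-- `a ⊗ b ↦ ε(b) a` -/
def homFst : H ⊗[k] H →ₗc[k] H :=
  (Coalgebra.TensorProduct.rid k k H).toCoalgHom.comp
    (Coalgebra.TensorProduct.map (.id k H) (Coalgebra.counitCoalgHom k H))

variable (k H) in
/-- `a ⊗ b ↦ ε(a) b` -/
def homSnd : H ⊗[k] H →ₗc[k] H :=
  (Coalgebra.TensorProduct.lid k H).toCoalgHom.comp
    (Coalgebra.TensorProduct.map (Coalgebra.counitCoalgHom k H) (.id k H))

@[simp] lemma homFst_tmul (a b : H) : homFst k H (a ⊗ₜ b) = counit (R := k) b • a := rfl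

@[simp] lemma homSnd_tmul (a b : H) : homSnd k H (a ⊗ₜ b) = counit (R := k) a • b := rfl

lemma pull_homSnd_mul_pull_homFst (f g : WithConv (H →ₗ[k] K)) (a b : H) :
    (pull (homSnd k H) f * pull (homFst k H) g).ofConv (a ⊗ₜ b) = f.ofConv b * g.ofConv a := by
  rw [convMul_tmul _ _ (ℛ k a) (ℛ k b), ← sum_counit_mul_left (ℛ k b) f.ofConv,
    ← sum_counit_mul_right (ℛ k a) g.ofConv, Finset.sum_mul_sum, Finset.sum_comm]
  refine Finset.sum_congr rfl fun i _ => Finset.sum_congr rfl fun j _ => ?_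
  simp only [pull_apply, homSnd_tmul, homFst_tmul, map_smul, smul_mul_smul_comm, mul_comm]

lemma pull_homFst_mul_pull_homSnd (f g : WithConv (H →ₗ[k] K)) (a b : H) :
    (pull (homFst k H) g * pull (homSnd k H) f).ofConv (a ⊗ₜ b) = g.ofConv a * f.ofConv b := by
  rw [convMul_tmul _ _ (ℛ k a) (ℛ k b), ← sum_counit_mul_right (ℛ k b) f.ofConv,
    ← sum_counit_mul_left (ℛ k a) g.ofConv, Finset.sum_mul_sum]
  refine Finset.sum_congr rfl fun i _ => Finset.sum_congr rfl fun j _ => ?_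
  simp only [pull_apply, homSnd_tmul, homFst_tmul, map_smul, smul_mul_smul_comm, mul_comm]

/-- The two forms depend on different tensor legs, so only commutativity of `K` is at stake. -/
lemma commute_pull_homSnd_pull_homFst (f g : WithConv (H →ₗ[k] K)) :
    Commute (pull (homSnd k H) f) (pull (homFst k H) g) :=
  form_ext fun a b => by
    rw [pull_homSnd_mul_pull_homFst, pull_homFst_mul_pull_homSnd, mul_comm]

end OfLegL

/-! ### Kronecker embeddings of matrix algebras -/

section Kronecker

variable {k m n K : Type*} [CommRing k] [Fintype m] [DecidableEq m] [Fintype n] [DecidableEq n]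
  [CommRing K] [Algebra k K]

variable (k m n K) in
/-- `A ↦ A ⊗ 1` -/
def kronLeft : Matrix m m K →ₐ[k] Matrix (m × n) (m × n) K :=
  AlgHom.ofLinearMap
    { toFun := fun A => Matrix.kronecker A 1
      map_add' := fun A B => Matrix.add_kronecker A B 1
      map_smul' := fun r A => Matrix.smul_kronecker r A 1 }
    Matrix.one_kronecker_one
    (fun A B => by simpa using Matrix.mul_kronecker_mul A B (1 : Matrix n n K) 1)

variable (k m n K) in
/-- `A ↦ 1 ⊗ A` -/
def kronRight : Matrix n n K →ₐ[k] Matrix (m × n) (m × n) K :=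
  AlgHom.ofLinearMap
    { toFun := fun A => Matrix.kronecker 1 A
      map_add' := fun A B => Matrix.kronecker_add 1 A B
      map_smul' := fun r A => Matrix.kronecker_smul r 1 A }
    Matrix.one_kronecker_one
    (fun A B => by simpa using Matrix.mul_kronecker_mul (1 : Matrix m m K) 1 A B)

lemma kronLeft_apply (A : Matrix m m K) (x y : m × n) :
    kronLeft k m n K A x y = A x.1 y.1 * (1 : Matrix n n K) x.2 y.2 := rfl

lemma kronRight_apply (A : Matrix n n K) (x y : m × n) :
    kronRight k m n K A x y = (1 : Matrix m m K) x.1 y.1 * A x.2 y.2 := rfl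

lemma kronLeft_mul_kronRight (A : Matrix m m K) (B : Matrix n n K) :
    kronLeft k m n K A * kronRight k m n K B = Matrix.kronecker A B := by
  simpa [kronLeft, kronRight] using
    (Matrix.mul_kronecker_mul A (1 : Matrix m m K) (1 : Matrix n n K) B).symm

lemma kronRight_mul_kronLeft (A : Matrix m m K) (B : Matrix n n K) :
    kronRight k m n K B * kronLeft k m n K A = Matrix.kronecker A B := by
  simpa [kronLeft, kronRight] using
    (Matrix.mul_kronecker_mul (1 : Matrix m m K) A B (1 : Matrix n n K)).symm

end Kronecker

section Entry

variable {k ι H K : Type*} [Field k] [Ring H] [Bialgebra k H] [CommRing K] [Algebra k K]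

/-- The `(i, j)` entry of a matrix of linear forms. -/
def entry (ρ : H →ₗ[k] Matrix ι ι K) (i j : ι) : WithConv (H →ₗ[k] K) :=
  toConv (Matrix.entryLinearMap k K i j ∘ₗ ρ)

@[simp] lemma entry_apply (ρ : H →ₗ[k] Matrix ι ι K) (i j : ι) (x : H) :
    (entry ρ i j).ofConv x = ρ x i j := rfl

end Entry

/-! ### Relations for matrix entries and quasi-commutativity with one generator argument -/

section Existence

variable {k ι H K : Type*} [Field k] [Fintype ι] [DecidableEq ι] [Ring H] [Bialgebra k H]
  [CommRing K] [Algebra k K] {S : Set (ι → ι → ι → ι → k)} {T : ι → ι → H}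

/-- Matrices of linear forms and linear maps into matrices are the same data; the two products agree
after exchanging the matrix sum with the coproduct sum. -/
lemma sum_entry_mul_entry {ρ σ : H →ₗ[k] Matrix ι ι K} (h : toConv ρ * toConv σ = 1) (i j : ι) :
    ∑ m, entry ρ i m * entry σ m j = if i = j then 1 else 0 := by
  ext x
  have h1 := congrArg (fun f : WithConv (H →ₗ[k] Matrix ι ι K) => f.ofConv x i j) h
  simp only [(ℛ k x).convMul_apply, LinearMap.convOne_apply, Matrix.sum_apply,
    Matrix.mul_apply] at h1
  rw [Finset.sum_comm] at h1
  simp only [ofConv_sum, LinearMap.sum_apply, (ℛ k x).convMul_apply, entry_apply, h1]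
  rw [Matrix.algebraMap_matrix_apply]
  split_ifs <;> simp

/-- If the matrices `Z` satisfy the relation `s`, then so do the entries of the antimultiplicative
map `ρ`, whose transposed values on generators are the `Z`. -/
lemma IsPresentation.rel_entry_eq_zero (hT : IsPresentation S T) (ρ : H →ₐ[k] (Matrix ι ι K)ᵐᵒᵖ)
    {s : ι → ι → ι → ι → k}
    (hs : ∀ i j p q, rel s (fun i p => Matrix.of fun j q => (ρ (T j q)).unop i p) i j p q = 0)
    (i j p q : ι) : rel s (entry (unopMap ρ)) i j p q = 0 := by
  have hcomm : ∀ x y, Commute ((kronRight k ι ι K).op (ρ x)) ((kronLeft k ι ι K).op (ρ y)) := by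
    intro x y
    apply MulOpposite.unop_injective
    exact (kronLeft_mul_kronRight _ _).trans (kronRight_mul_kronLeft _ _).symm
  have hcomm' : ∀ x y, Commute ((kronLeft k ι ι K).op (ρ x)) ((kronRight k ι ι K).op (ρ y)) :=
    fun x y => (hcomm y x).symm
  -- The products of two entries are the coefficients of the tensor square of `ρ`, again an
  -- antimultiplicative representation. The relation says that its values commute with the matrix of
  -- `s`, which can be tested on generators.
  obtain ⟨ρ₂, hρ₂⟩ : ∃ ρ₂ : H →ₐ[k] (Matrix (ι × ι) (ι × ι) K)ᵐᵒᵖ, ∀ x (i j p q : ι),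
      (ρ₂ x).unop (i, j) (p, q) =
        (entry (unopMap ρ) i p * entry (unopMap ρ) j q).ofConv x := by
    refine ⟨convHom ((kronLeft k ι ι K).op.comp ρ) ((kronRight k ι ι K).op.comp ρ) hcomm',
      fun x i j p q => ?_⟩
    rw [(ℛ k x).convMul_apply]
    refine (congrArg (fun M : (Matrix (ι × ι) (ι × ι) K)ᵐᵒᵖ => M.unop (i, j) (p, q))
      (convHom_apply _ _ hcomm' (ℛ k x))).trans ?_
    rw [Finset.unop_sum, Matrix.sum_apply]
    refine Finset.sum_congr rfl fun l _ => ?_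
    exact congrFun₂ (kronRight_mul_kronLeft (k := k) (ρ ((ℛ k x).left l)).unop
      (ρ ((ℛ k x).right l)).unop) (i, j) (p, q)
  have hx : ∀ x, Commute (relMatrix K s) (ρ₂ x).unop := by
    intro x
    induction x using hT.induction with
    | algebraMap r =>
      rw [AlgHom.commutes]
      exact (Algebra.commutes r (relMatrix K s)).symm
    | gen a b =>
      rw [commute_iff_eq, ← Matrix.ext_iff]
      rintro ⟨i, j⟩ ⟨p, q⟩
      -- Evaluated at `T_a^b`, the convolution product becomes a matrix product, and the claim is
      -- the `(a, b)` entry of the matrix relation `hs`.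
      have h0 := congrFun₂ (hs i j p q) a b
      simp only [rel, Matrix.sub_apply, Matrix.sum_apply, Matrix.smul_apply, Matrix.mul_apply,
        Matrix.of_apply, Matrix.zero_apply, sub_eq_zero] at h0
      simp only [Algebra.smul_def] at h0
      simp only [Matrix.mul_apply, Fintype.sum_prod_type, hρ₂, (hT.repr a b).convMul_apply,
        relMatrix, Matrix.of_apply]
      simp only [IsPresentation.repr, entry_apply, unopMap_apply]
      rw [h0]
      simp only [mul_comm]
    | mul a b ha hb => rw [map_mul, MulOpposite.unop_mul]; exact hb.mul_right ha
    | add a b ha hb => rw [map_add, MulOpposite.unop_add]; exact ha.add_right hb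
  ext x
  have h1 := congrFun₂ (hx x).eq (i, j) (p, q)
  simp only [Matrix.mul_apply, Fintype.sum_prod_type, hρ₂, relMatrix, Matrix.of_apply] at h1
  simp only [rel, ofConv_sub, ofConv_sum, ofConv_smul, LinearMap.sub_apply, LinearMap.sum_apply,
    LinearMap.smul_apply, ofConv_zero, LinearMap.zero_apply, sub_eq_zero]
  simp only [Algebra.smul_def, h1]
  simp only [mul_comm]

/-- `R(a₁ ⊗ b₁) ⊗ a₂ b₂ = R(a₂ ⊗ b₂) ⊗ b₁ a₁` for a form with values in `K`. -/
def IsQuasiCommutative (f : WithConv (H ⊗[k] H →ₗ[k] K)) : Prop :=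
  push Algebra.TensorProduct.includeLeft f *
      toConv ((Algebra.TensorProduct.includeRight : H →ₐ[k] K ⊗[k] H).toLinearMap ∘ₗ
        LinearMap.mul' k H) =
    toConv ((Algebra.TensorProduct.includeRight : H →ₐ[k] K ⊗[k] H).toLinearMap ∘ₗ
        LinearMap.mul' k H ∘ₗ (TensorProduct.comm k H H).toLinearMap) *
      push Algebra.TensorProduct.includeLeft f

/-- A functional `l` extracts scalar identities from the one in `K ⊗ H`: the identity of `k` for a
scalar form, the coefficient of `ε` for a form with values in the dual numbers. -/
lemma IsQuasiCommutative.unitForm_mul {f : WithConv (H ⊗[k] H →ₗ[k] K)}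
    (hf : IsQuasiCommutative f) (l : K →ₗ[k] k) :
    unitForm (toConv (l ∘ₗ f.ofConv)) * convMult k H =
      convMultOp k H * unitForm (toConv (l ∘ₗ f.ofConv)) := by
  refine form_ext fun a b => ?_
  have h := congrArg (fun g : WithConv (H ⊗[k] H →ₗ[k] K ⊗[k] H) =>
    TensorProduct.lid k H (TensorProduct.map l LinearMap.id (g.ofConv (a ⊗ₜ b)))) hf
  simp only [convMul_tmul _ _ (ℛ k a) (ℛ k b), map_sum] at h ⊢
  simpa [unitForm, convMult, convMultOp, Algebra.algebraMap_eq_smul_one] using h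

/-- The matrix representation `a ↦ f(a ⊗ T_j^l)`. -/
def IsBicharacter.matrixHom {f : WithConv (H ⊗[k] H →ₗ[k] K)} (hf : IsBicharacter f)
    (hT : IsPresentation S T) : H →ₐ[k] Matrix ι ι K :=
  AlgHom.ofLinearMap
    { toFun := fun a => .of fun j l => f.ofConv (a ⊗ₜ T j l)
      map_add' := fun a b => by ext; simp [TensorProduct.add_tmul]
      map_smul' := fun r a => by ext; simp [← TensorProduct.smul_tmul'] }
    (by
      ext j l
      have := congrArg (fun g : WithConv (H →ₗ[k] K) => g.ofConv (T j l)) hf.one_left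
      simp only [legL_apply, LinearMap.convOne_apply, hT.counit] at this
      simp [this, Matrix.one_apply, apply_ite (algebraMap k K)])
    (fun a b => by
      ext j l
      have := congrArg (fun g : WithConv (H →ₗ[k] K) => g.ofConv (T j l)) (hf.mul_left a b)
      simp only [legL_apply, (hT.repr j l).convMul_apply] at this
      simpa [Matrix.mul_apply, IsPresentation.repr] using this)

/-- With a generator in the second argument, the claim is an intertwining relation: the matrix `N`
of generators intertwines the convolution products `φ * ψ` and `ψ * φ`, where `φ` records `f` and
`ψ` the element of `H` as a scalar matrix. Both are algebra maps of `a`, so generators suffice. -/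
lemma IsBicharacter.quasiCommutative_gen {f : WithConv (H ⊗[k] H →ₗ[k] K)}
    (hf : IsBicharacter f) (hT : IsPresentation S T)
    (hgen : ∀ i j p q, ∑ m, ∑ n, f.ofConv (T i m ⊗ₜ T j n) ⊗ₜ[k] (T m p * T n q) =
      ∑ m, ∑ n, f.ofConv (T m p ⊗ₜ T n q) ⊗ₜ[k] (T j n * T i m))
    {κ : Type*} {a : H} (r : Repr k a κ) (j q : ι) :
    ∑ i ∈ r.index, ∑ n, f.ofConv (r.left i ⊗ₜ T j n) ⊗ₜ[k] (r.right i * T n q) =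
      ∑ i ∈ r.index, ∑ n, f.ofConv (r.right i ⊗ₜ T n q) ⊗ₜ[k] (T j n * r.left i) := by
  obtain ⟨φ, hφ⟩ : ∃ φ : H →ₐ[k] Matrix ι ι (K ⊗[k] H),
      ∀ x j l, φ x j l = f.ofConv (x ⊗ₜ T j l) ⊗ₜ[k] 1 :=
    ⟨(Algebra.TensorProduct.includeLeft : K →ₐ[k] K ⊗[k] H).mapMatrix.comp (hf.matrixHom hT),
      fun _ _ _ => rfl⟩
  obtain ⟨ψ, hψ⟩ : ∃ ψ : H →ₐ[k] Matrix ι ι (K ⊗[k] H),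
      ∀ x, ψ x = Matrix.diagonal fun _ => (1 : K) ⊗ₜ[k] x :=
    ⟨(Matrix.scalarAlgHom ι k).comp (Algebra.TensorProduct.includeRight : H →ₐ[k] K ⊗[k] H),
      fun _ => rfl⟩
  have hφψ : ∀ x y, Commute (φ x) (ψ y) := by
    intro x y
    rw [commute_iff_eq, ← Matrix.ext_iff]
    intro i j
    simp [hφ, hψ]
  have hψφ : ∀ x y, Commute (ψ x) (φ y) := fun x y => (hφψ y x).symm
  let N : Matrix ι ι (K ⊗[k] H) := Matrix.of fun j l => (1 : K) ⊗ₜ[k] T j l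
  have hl : ∀ x y j q, (φ x * ψ y * N) j q =
      ∑ n, f.ofConv (x ⊗ₜ T j n) ⊗ₜ[k] (y * T n q) := by
    intro x y j q
    simp [Matrix.mul_apply (N := N), hφ, hψ, N]
  have hr : ∀ x y j q, (N * (ψ x * φ y)) j q =
      ∑ n, f.ofConv (y ⊗ₜ T n q) ⊗ₜ[k] (T j n * x) := by
    intro x y j q
    simp [Matrix.mul_apply (M := N), hφ, hψ, N]
  have h := congrFun₂ (hT.convHom_intertwine φ ψ hφψ hψφ N (fun i p => ?_) a) j q
  · rw [convHom_apply _ _ _ r, convHom_apply _ _ _ r, Finset.sum_mul, Finset.mul_sum,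
      Matrix.sum_apply, Matrix.sum_apply] at h
    simpa only [hl, hr] using h
  · ext j q
    rw [convHom_apply _ _ _ (hT.repr i p), convHom_apply _ _ _ (hT.repr i p), Finset.sum_mul,
      Finset.mul_sum, Matrix.sum_apply, Matrix.sum_apply]
    simp only [hl, hr]
    exact hgen i j p q

/-- The constant functions `x ↦ ε(x) a` of the convolution algebra. -/
def convConst (A : Type*) [Ring A] [Algebra k A] : A →ₐ[k] WithConv (H →ₗ[k] A) :=
  AlgHom.ofLinearMap
    { toFun := fun a => toConv ((LinearMap.toSpanSingleton k A a) ∘ₗ counit)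
      map_add' := fun a b => by ext; simp
      map_smul' := fun r a => by ext x; exact smul_comm (counit x) r a }
    (by ext; simp [Algebra.algebraMap_eq_smul_one])
    (fun a b => by
      ext x
      refine Eq.trans ?_ ((ℛ k x).convMul_apply _ _).symm
      change counit (R := k) x • (a * b) = ∑ i ∈ (ℛ k x).index,
        (counit (R := k) ((ℛ k x).left i) • a) * (counit (R := k) ((ℛ k x).right i) • b)
      have h := sum_counit_mul_right (ℛ k x) (counit (R := k) (A := H))
      simp only [smul_eq_mul] at h
      simp only [smul_mul_smul_comm, ← Finset.sum_smul, h])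

@[simp] lemma convConst_apply {A : Type*} [Ring A] [Algebra k A] (a : A) (x : H) :
    (convConst (k := k) A a).ofConv x = counit (R := k) x • a := rfl

lemma convConst_mul {A : Type*} [Ring A] [Algebra k A] (a : A) (f : WithConv (H →ₗ[k] A)) (x : H) :
    (convConst A a * f).ofConv x = a * f.ofConv x := by
  rw [(ℛ k x).convMul_apply, ← sum_counit_mul_right (ℛ k x) f.ofConv, Finset.mul_sum]
  simp

lemma mul_convConst {A : Type*} [Ring A] [Algebra k A] (a : A) (f : WithConv (H →ₗ[k] A)) (x : H) :
    (f * convConst A a).ofConv x = f.ofConv x * a := by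
  rw [(ℛ k x).convMul_apply, ← sum_counit_mul_left (ℛ k x) f.ofConv, Finset.sum_mul]
  simp

end Existence

/-! ### Quasi-commutativity in both arguments -/

section QuasiCommutative

variable {k ι H K : Type*} [Field k] [Fintype ι] [DecidableEq ι] [Ring H] [Bialgebra k H]
  [CommRing K] [Algebra k K] {S : Set (ι → ι → ι → ι → k)} {T : ι → ι → H}

/-- Quasi-commutativity of a bicharacter only has to be checked on generators. -/
lemma IsBicharacter.isQuasiCommutative {f : WithConv (H ⊗[k] H →ₗ[k] K)}
    (hf : IsBicharacter f) (hT : IsPresentation S T)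
    (hgen : ∀ i j p q, ∑ m, ∑ n, f.ofConv (T i m ⊗ₜ T j n) ⊗ₜ[k] (T m p * T n q) =
      ∑ m, ∑ n, f.ofConv (T m p ⊗ₜ T n q) ⊗ₜ[k] (T j n * T i m)) : IsQuasiCommutative f := by
  obtain ⟨c, hc⟩ : ∃ c : K →ₐ[k] (K ⊗[k] H)ᵐᵒᵖ, ∀ x, c x = MulOpposite.op (x ⊗ₜ[k] 1) :=
    ⟨(Algebra.TensorProduct.includeLeft : K →ₐ[k] K ⊗[k] H).toOpposite fun x y => by
      simp [commute_iff_eq, mul_comm], fun _ => rfl⟩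
  -- The outer opposite makes the antimultiplicative map `b ↦ f(- ⊗ b)` an algebra map. The inner
  -- one compensates for it in `ψ`, whose values do not lie in a commutative algebra.
  obtain ⟨φ, hφ⟩ : ∃ φ : H →ₐ[k] (WithConv (H →ₗ[k] (K ⊗[k] H)ᵐᵒᵖ))ᵐᵒᵖ, ∀ b,
      φ b = MulOpposite.op (push c (legR f b)) :=
    ⟨(push c).op.comp hf.right, fun _ => rfl⟩
  obtain ⟨ψ, hψ⟩ : ∃ ψ : H →ₐ[k] (WithConv (H →ₗ[k] (K ⊗[k] H)ᵐᵒᵖ))ᵐᵒᵖ,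
      ∀ b, ψ b = MulOpposite.op (convConst _ (MulOpposite.op ((1 : K) ⊗ₜ[k] b))) :=
    ⟨((convConst (k := k) (H := H) (K ⊗[k] H)ᵐᵒᵖ).op.comp
      (AlgEquiv.opOp k (K ⊗[k] H)).toAlgHom).comp
      Algebra.TensorProduct.includeRight, fun _ => rfl⟩
  let N : WithConv (H →ₗ[k] (K ⊗[k] H)ᵐᵒᵖ) := toConv ((MulOpposite.opLinearEquiv k).toLinearMap ∘ₗ
    (Algebra.TensorProduct.includeRight : H →ₐ[k] K ⊗[k] H).toLinearMap)
  have hψφ : ∀ x y, Commute (ψ x) (φ y) := by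
    intro x y
    rw [hφ, hψ, commute_iff_eq]
    apply MulOpposite.unop_injective
    ext a
    refine (mul_convConst _ _ a).trans (Eq.trans ?_ (convConst_mul _ _ a).symm)
    apply MulOpposite.unop_injective
    simp [hc]
  have hφψ : ∀ x y, Commute (φ x) (ψ y) := fun x y => (hψφ y x).symm
  have hl : ∀ x y a, ((ψ x * φ y * MulOpposite.op N).unop.ofConv a).unop =
        ∑ i ∈ (ℛ k a).index, f.ofConv ((ℛ k a).right i ⊗ₜ y) ⊗ₜ[k] (x * (ℛ k a).left i) := by
    intro x y a
    have h := ((ℛ k a).convMul_apply N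
      (push c (legR f y) * convConst _ (MulOpposite.op ((1 : K) ⊗ₜ[k] x))))
    simp only [mul_convConst] at h
    rw [hφ, hψ]
    refine (congrArg MulOpposite.unop h).trans ?_
    simp [N, hc, Finset.unop_sum]
  have hr : ∀ x y a, ((MulOpposite.op N * (φ x * ψ y)).unop.ofConv a).unop =
        ∑ i ∈ (ℛ k a).index, f.ofConv ((ℛ k a).left i ⊗ₜ x) ⊗ₜ[k] ((ℛ k a).right i * y) := by
    intro x y a
    have h := ((ℛ k a).convMul_apply
      (convConst _ (MulOpposite.op ((1 : K) ⊗ₜ[k] y)) * push c (legR f x)) N)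
    simp only [convConst_mul] at h
    rw [hφ, hψ]
    refine (congrArg MulOpposite.unop h).trans ?_
    simp [N, hc, Finset.unop_sum]
  have hsum : ∀ (κ : Finset ι) (g : ι → (WithConv (H →ₗ[k] (K ⊗[k] H)ᵐᵒᵖ))ᵐᵒᵖ) (a : H),
      ((∑ i ∈ κ, g i).unop.ofConv a).unop = ∑ i ∈ κ, ((g i).unop.ofConv a).unop := by
    intro κ g a
    rw [Finset.unop_sum, ofConv_sum, LinearMap.sum_apply, Finset.unop_sum]
  refine form_ext fun a b => ?_
  -- The second argument `b` is now reduced to generators, with `N` recording the first argument; on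
  -- generators the identity is `IsBicharacter.quasiCommutative_gen`.
  have h := congrArg (fun x : (WithConv (H →ₗ[k] (K ⊗[k] H)ᵐᵒᵖ))ᵐᵒᵖ => (x.unop.ofConv a).unop)
    (hT.convHom_intertwine ψ φ hψφ hφψ (MulOpposite.op N) (fun j q => ?_) b)
  · rw [convHom_apply _ _ _ (ℛ k b), convHom_apply _ _ _ (ℛ k b), Finset.sum_mul,
      Finset.mul_sum] at h
    rw [Finset.unop_sum, ofConv_sum, LinearMap.sum_apply, Finset.unop_sum,
      Finset.unop_sum, ofConv_sum, LinearMap.sum_apply, Finset.unop_sum] at h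
    simp only [hl, hr] at h
    rw [convMul_tmul _ _ (ℛ k a) (ℛ k b), convMul_tmul _ _ (ℛ k a) (ℛ k b), Finset.sum_comm]
    rw [Finset.sum_comm (s := (ℛ k a).index)]
    simpa using h.symm
  · apply MulOpposite.unop_injective
    ext a
    apply MulOpposite.unop_injective
    rw [convHom_apply _ _ _ (hT.repr j q), convHom_apply _ _ _ (hT.repr j q), Finset.sum_mul,
      Finset.mul_sum, hsum, hsum]
    simp only [hl, hr]
    rw [Finset.sum_comm]
    rw [Finset.sum_comm (t := (ℛ k a).index)]
    exact (hf.quasiCommutative_gen hT hgen (ℛ k a) j q).symm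

end QuasiCommutative

section Block

variable {ι K : Type*}

/-- The block `(M_{(i,j),(p,q)})_{i,p}` of the matrix `M`. -/
def block (M : Matrix (ι × ι) (ι × ι) K) (j q : ι) : Matrix ι ι K :=
  Matrix.of fun i p => M (i, j) (p, q)

@[simp] lemma block_apply (M : Matrix (ι × ι) (ι × ι) K) (i j p q : ι) :
    block M j q i p = M (i, j) (p, q) := rfl

end Block

/-! ### Existence and uniqueness of bicharacters -/

section Existence

variable {k ι H K : Type*} [Field k] [Fintype ι] [DecidableEq ι] [Ring H] [Bialgebra k H]
  [CommRing K] [Algebra k K] {S : Set (ι → ι → ι → ι → k)} {T : ι → ι → H}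

/-- As functions of the first argument, `a ↦ f(a ⊗ bc)` and `a ↦ f(a₁ ⊗ c) f(a₂ ⊗ b)` are algebra
maps into the convolution algebra on `H ⊗ H`. On generators they agree because `ρ` is
antimultiplicative. -/
lemma IsPresentation.mul_right_of_gen (hT : IsPresentation S T)
    (L : H →ₐ[k] WithConv (H →ₗ[k] K)) (ρ : H →ₐ[k] (Matrix ι ι K)ᵐᵒᵖ)
    (hL : ∀ i j, L (T i j) = entry (unopMap ρ) i j) (b c : H) :
    legR (ofLegL L.toLinearMap) (b * c) =
      legR (ofLegL L.toLinearMap) c * legR (ofLegL L.toLinearMap) b := by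
  obtain ⟨φ, hφ⟩ : ∃ φ : H →ₐ[k] WithConv (H ⊗[k] H →ₗ[k] K),
      ∀ x, φ x = pull (homSnd k H) (L x) := ⟨(pull (homSnd k H)).comp L, fun _ => rfl⟩
  obtain ⟨ψ, hψ⟩ : ∃ ψ : H →ₐ[k] WithConv (H ⊗[k] H →ₗ[k] K),
      ∀ x, ψ x = pull (homFst k H) (L x) := ⟨(pull (homFst k H)).comp L, fun _ => rfl⟩
  have hφψ : ∀ x y, Commute (φ x) (ψ y) := fun x y => by
    rw [hφ, hψ]
    exact commute_pull_homSnd_pull_homFst _ _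
  have happ : ∀ x y a b, (φ x * ψ y).ofConv (a ⊗ₜ b) = (L x).ofConv b * (L y).ofConv a :=
    fun x y a b => by rw [hφ, hψ, pull_homSnd_mul_pull_homFst]
  have h : (pull (Bialgebra.mulCoalgHom k H)).comp L = convHom φ ψ hφψ := by
    refine hT.algHom_ext fun i j => ?_
    rw [convHom_apply _ _ _ (hT.repr i j)]
    refine form_ext fun a b => ?_
    simp only [ofConv_sum, LinearMap.sum_apply, happ]
    simp [IsPresentation.repr, hL, Matrix.mul_apply]
  ext a
  have h1 := congrArg (fun g : WithConv (H ⊗[k] H →ₗ[k] K) => g.ofConv (b ⊗ₜ c))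
    (DFunLike.congr_fun h a)
  rw [convHom_apply _ _ _ (ℛ k a)] at h1
  simp only [ofConv_sum, LinearMap.sum_apply, happ] at h1
  rw [(ℛ k a).convMul_apply]
  simpa using h1

lemma sum_block_mul_block {M M' : Matrix (ι × ι) (ι × ι) K} (h : M * M' = 1) (i j : ι) :
    ∑ m, block M i m * block M' m j = if i = j then (1 : Matrix ι ι K) else 0 := by
  ext a b
  have := congrFun₂ h (a, i) (b, j)
  simp only [Matrix.mul_apply, Fintype.sum_prod_type_right, Matrix.one_apply,
    Prod.mk.injEq] at this
  simp only [Matrix.sum_apply, Matrix.mul_apply, block_apply, this]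
  by_cases hij : i = j <;> simp [hij, Matrix.one_apply]

/-- The matrix representation `ρ` attached to `M` and its convolution inverse. -/
lemma IsPresentation.exists_matrixHom (hT : IsPresentation S T)
    {M M' : Matrix (ι × ι) (ι × ι) K} (hM : M * M' = 1) (hM' : M' * M = 1)
    (hr : ∀ s ∈ S, ∀ i j p q, rel s (fun j l => MulOpposite.op (block M j l)) i j p q = 0) :
    ∃ (ρ : H →ₐ[k] (Matrix ι ι K)ᵐᵒᵖ) (σ : H →ₐ[k] Matrix ι ι K),
      (∀ i j, (ρ (T i j)).unop = block M i j) ∧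
      toConv (unopMap ρ) * toConv σ.toLinearMap = 1 ∧
      toConv σ.toLinearMap * toConv (unopMap ρ) = 1 := by
  obtain ⟨ρ, hρ⟩ := hT.exists_lift _ hr
  -- The blocks of `M'` are inverse to those of `M`, hence satisfy the relations without the
  -- opposite.
  obtain ⟨σ, hσ⟩ := hT.exists_lift (block M') fun s hs =>
    rel_of_op_inverse (sum_block_mul_block hM) (sum_block_mul_block hM') (hr s hs)
  refine ⟨ρ, σ, fun i j => by rw [hρ, MulOpposite.unop_op], ?_, ?_⟩
  · refine hT.conv_unop_mul_eq_one σ ρ fun i j => ?_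
    simp only [hρ, hσ, MulOpposite.unop_op]
    exact sum_block_mul_block hM i j
  · refine hT.conv_mul_unop_eq_one σ ρ fun i j => ?_
    simp only [hρ, hσ, MulOpposite.unop_op]
    exact sum_block_mul_block hM' i j

/-- A convolution invertible form whose restriction to generators is `ρ`. -/
lemma IsPresentation.exists_unit (hT : IsPresentation S T)
    {ρ σ : H →ₗ[k] Matrix ι ι K} (hρσ : toConv ρ * toConv σ = 1) (hσρ : toConv σ * toConv ρ = 1)
    (hrel : ∀ s ∈ S, ∀ i j p q, rel s (entry ρ) i j p q = 0) :
    ∃ (R : (WithConv (H ⊗[k] H →ₗ[k] K))ˣ) (L : H →ₐ[k] WithConv (H →ₗ[k] K)),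
      R.val = ofLegL L.toLinearMap ∧ ∀ i j, L (T i j) = entry ρ i j := by
  have h1 := sum_entry_mul_entry hρσ
  have h2 := sum_entry_mul_entry hσρ
  obtain ⟨L, hL⟩ := hT.exists_lift (entry ρ) hrel
  -- The inverse form comes from the entries of `σ`: they are inverse to those of `ρ`, so they
  -- satisfy the opposite relations and define an antimultiplicative map.
  obtain ⟨L', hL'⟩ := hT.exists_lift (fun i j => MulOpposite.op (entry σ i j)) fun s hs =>
    rel_op_of_inverse h1 h2 (hrel s hs)
  have hLL' : toConv L.toLinearMap * toConv (unopMap L') = 1 := by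
    refine hT.conv_mul_unop_eq_one L L' fun i j => ?_
    simp only [hL, hL', MulOpposite.unop_op]
    exact h1 i j
  have hL'L : toConv (unopMap L') * toConv L.toLinearMap = 1 := by
    refine hT.conv_unop_mul_eq_one L L' fun i j => ?_
    simp only [hL, hL', MulOpposite.unop_op]
    exact h2 i j
  exact ⟨⟨ofLegL L.toLinearMap, ofLegL (unopMap L'), ofLegL_mul_eq_one hLL',
    ofLegL_mul_eq_one hL'L⟩, L, rfl, hL⟩

/-- Existence of the bicharacter with values in `K` attached to an invertible matrix `M`. -/
theorem IsPresentation.exists_bicharacter (hT : IsPresentation S T)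
    {M M' : Matrix (ι × ι) (ι × ι) K} (hM : M * M' = 1) (hM' : M' * M = 1)
    (hr : ∀ s ∈ S, ∀ i j p q, rel s (fun j l => MulOpposite.op (block M j l)) i j p q = 0)
    (hl : ∀ s ∈ S, ∀ i j p q, rel s (fun i p => Matrix.of fun j l => M (i, j) (p, l)) i j p q = 0)
    (hgen : ∀ i j p q, ∑ m, ∑ n, M (i, j) (m, n) ⊗ₜ[k] (T m p * T n q) =
      ∑ m, ∑ n, M (m, n) (p, q) ⊗ₜ[k] (T j n * T i m)) :
    ∃ R : (WithConv (H ⊗[k] H →ₗ[k] K))ˣ, IsBicharacter R.val ∧ IsQuasiCommutative R.val ∧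
      ∀ i j p q, R.val.ofConv (T i p ⊗ₜ T j q) = M (i, j) (p, q) := by
  obtain ⟨ρ, σ, hρ, hρσ, hσρ⟩ := hT.exists_matrixHom hM hM' hr
  obtain ⟨R, L, hR, hL⟩ := hT.exists_unit hρσ hσρ fun s hs =>
    hT.rel_entry_eq_zero ρ (by simpa only [hρ, block_apply] using hl s hs)
  have hgenR : ∀ i j p q, R.val.ofConv (T i p ⊗ₜ T j q) = M (i, j) (p, q) := fun i j p q => by
    simp [hR, hL, hρ]
  have hR : IsBicharacter R.val := isBicharacter_of_isUnit R.isUnit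
    (fun a b => by rw [hR]; exact map_mul L a b)
    (fun a b => by rw [hR]; exact hT.mul_right_of_gen L ρ hL a b)
  exact ⟨R, hR, hR.isQuasiCommutative hT (by simpa only [hgenR] using hgen), hgenR⟩

/-- A bicharacter is determined by its values on generators. -/
theorem IsPresentation.bicharacter_ext (hT : IsPresentation S T)
    {f g : WithConv (H ⊗[k] H →ₗ[k] K)} (hf : IsBicharacter f) (hg : IsBicharacter g)
    (h : ∀ i j p q, f.ofConv (T i p ⊗ₜ T j q) = g.ofConv (T i p ⊗ₜ T j q)) : f = g := by
  -- The first argument is freed from the generators by multiplicativity of `a ↦ f(a ⊗ T)`, then the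
  -- second by antimultiplicativity of `b ↦ f(- ⊗ b)`.
  have h1 : ∀ (a : H) (j q : ι), f.ofConv (a ⊗ₜ T j q) = g.ofConv (a ⊗ₜ T j q) := by
    have : hf.matrixHom hT = hg.matrixHom hT :=
      hT.algHom_ext fun i p => by ext j q; exact h i j p q
    intro a j q
    exact congrFun₂ (DFunLike.congr_fun this a) j q
  have h2 : hf.right = hg.right := hT.algHom_ext fun j q => by
    apply MulOpposite.unop_injective
    ext a
    exact h1 a j q
  refine form_ext fun a b => ?_
  exact congrArg (fun x : (WithConv (H →ₗ[k] K))ᵐᵒᵖ => x.unop.ofConv a) (DFunLike.congr_fun h2 b)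

end Existence

/-! ### Legs of matrices -/

section LegMatrices

variable {ι K : Type*} [Fintype ι] [DecidableEq ι] [CommRing K]

variable (ι K) in
/-- `M₁₂ = M ⊗ 1` -/
def mat12 : Matrix (ι × ι) (ι × ι) K →ₐ[K] Matrix ((ι × ι) × ι) ((ι × ι) × ι) K :=
  kronLeft K (ι × ι) ι K

variable (ι K) in
/-- `M₂₃ = 1 ⊗ M` -/
def mat23 : Matrix (ι × ι) (ι × ι) K →ₐ[K] Matrix ((ι × ι) × ι) ((ι × ι) × ι) K :=
  (Matrix.reindexAlgEquiv K K (Equiv.prodAssoc ι ι ι).symm).toAlgHom.comp (kronRight K ι (ι × ι) K)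

lemma mat12_apply (M : Matrix (ι × ι) (ι × ι) K) (i j l p q r : ι) :
    mat12 ι K M ((i, j), l) ((p, q), r) = if l = r then M (i, j) (p, q) else 0 := by
  simp [mat12, kronLeft_apply, Matrix.one_apply]

lemma mat23_apply (M : Matrix (ι × ι) (ι × ι) K) (i j l p q r : ι) :
    mat23 ι K M ((i, j), l) ((p, q), r) = if i = p then M (j, l) (q, r) else 0 := by
  simp [mat23, kronRight_apply, Matrix.one_apply]

lemma mat12_map {k : Type*} [CommRing k] [Algebra k K] (M : Matrix (ι × ι) (ι × ι) k) :
    mat12 ι K (M.map (algebraMap k K)) = (mat12 ι k M).map (algebraMap k K) := by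
  ext ⟨⟨i, j⟩, l⟩ ⟨⟨p, q⟩, r⟩
  simp [mat12_apply, apply_ite (algebraMap k K)]

lemma mat23_map {k : Type*} [CommRing k] [Algebra k K] (M : Matrix (ι × ι) (ι × ι) k) :
    mat23 ι K (M.map (algebraMap k K)) = (mat23 ι k M).map (algebraMap k K) := by
  ext ⟨⟨i, j⟩, l⟩ ⟨⟨p, q⟩, r⟩
  simp [mat23_apply, apply_ite (algebraMap k K)]

lemma mat12_mul_apply (M : Matrix (ι × ι) (ι × ι) K) (X : Matrix ((ι × ι) × ι) ((ι × ι) × ι) K)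
    (i j l : ι) (y : (ι × ι) × ι) :
    (mat12 ι K M * X) ((i, j), l) y = ∑ m, ∑ n, M (i, j) (m, n) * X ((m, n), l) y := by
  simp [Matrix.mul_apply, Fintype.sum_prod_type, mat12_apply]

lemma mat23_mul_apply (M : Matrix (ι × ι) (ι × ι) K) (X : Matrix ((ι × ι) × ι) ((ι × ι) × ι) K)
    (i j l : ι) (y : (ι × ι) × ι) :
    (mat23 ι K M * X) ((i, j), l) y = ∑ m, ∑ n, M (j, l) (m, n) * X ((i, m), n) y := by
  simp [Matrix.mul_apply, Fintype.sum_prod_type, mat23_apply]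

lemma mul_mat12_apply (M : Matrix (ι × ι) (ι × ι) K) (X : Matrix ((ι × ι) × ι) ((ι × ι) × ι) K)
    (p q r : ι) (x : (ι × ι) × ι) :
    (X * mat12 ι K M) x ((p, q), r) = ∑ m, ∑ n, X x ((m, n), r) * M (m, n) (p, q) := by
  simp [Matrix.mul_apply, Fintype.sum_prod_type, mat12_apply]

lemma mul_mat23_apply (M : Matrix (ι × ι) (ι × ι) K) (X : Matrix ((ι × ι) × ι) ((ι × ι) × ι) K)
    (p q r : ι) (x : (ι × ι) × ι) :
    (X * mat23 ι K M) x ((p, q), r) = ∑ m, ∑ n, X x ((p, m), n) * M (m, n) (q, r) := by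
  simp [Matrix.mul_apply, Fintype.sum_prod_type, mat23_apply]

lemma mat12_mul_mat23_apply (M N : Matrix (ι × ι) (ι × ι) K) (i j l p q r : ι) :
    (mat12 ι K M * mat23 ι K N) ((i, j), l) ((p, q), r) =
      ∑ m, M (i, j) (p, m) * N (m, l) (q, r) := by
  simp [mat12_mul_apply, mat23_apply]

lemma mat23_mul_mat12_apply (M N : Matrix (ι × ι) (ι × ι) K) (i j l p q r : ι) :
    (mat23 ι K M * mat12 ι K N) ((i, j), l) ((p, q), r) =
      ∑ m, M (j, l) (m, r) * N (i, m) (p, q) := by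
  simp [mat23_mul_apply, mat12_apply]

/-- The matrix `(M_{(j,i),(p,q)})`. -/
def swapRows (M : Matrix (ι × ι) (ι × ι) K) : Matrix (ι × ι) (ι × ι) K :=
  M.submatrix Prod.swap id

lemma swapRows_mul {M M' : Matrix (ι × ι) (ι × ι) K} (h : M * M' = 1) :
    swapRows M * M'.submatrix id Prod.swap = 1 := by
  have := Matrix.submatrix_mul M M' Prod.swap id Prod.swap Function.bijective_id
  rw [swapRows, ← this, h]
  exact Matrix.submatrix_one_equiv (Equiv.prodComm ι ι)

lemma mul_swapRows {M M' : Matrix (ι × ι) (ι × ι) K} (h : M' * M = 1) :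
    M'.submatrix id Prod.swap * swapRows M = 1 := by
  have := Matrix.submatrix_mul M' M id Prod.swap id Prod.swap_bijective
  rw [swapRows, ← this, h]
  rfl

variable {k : Type*} [Field k] [Algebra k K]

/-- The leg identity is read entrywise: the third source index and the first target index become the
row and column of the blocks, the other four are the indices of the relation. -/
lemma rel_op_block {s : ι → ι → ι → ι → k} {M : Matrix (ι × ι) (ι × ι) K}
    (h : mat12 ι K (relMatrix K s) * (mat23 ι K M * mat12 ι K M) =
      mat23 ι K M * mat12 ι K M * mat23 ι K (relMatrix K s)) (i j p q : ι) :
    rel s (fun j l => MulOpposite.op (block (swapRows M) j l)) i j p q = 0 := by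
  rw [rel, sub_eq_zero]
  apply MulOpposite.unop_injective
  ext a b
  have h1 := congrFun₂ h ((i, j), a) ((b, p), q)
  rw [mat12_mul_apply, mul_mat23_apply] at h1
  simp only [mat23_mul_mat12_apply] at h1
  simp only [← MulOpposite.op_mul, ← MulOpposite.op_smul, ← Finset.op_sum, MulOpposite.unop_op,
    Matrix.sum_apply, Matrix.smul_apply, Matrix.mul_apply]
  simp only [Algebra.smul_def]
  exact h1.trans (Finset.sum_congr rfl fun x _ => Finset.sum_congr rfl fun y _ => mul_comm _ _)

/-- The mirror image of `rel_op_block`: the first source index and the third target index are now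
the matrix indices. -/
lemma rel_left {s : ι → ι → ι → ι → k} {M : Matrix (ι × ι) (ι × ι) K}
    (h : mat23 ι K (relMatrix K s) * (mat12 ι K M * mat23 ι K M) =
      mat12 ι K M * mat23 ι K M * mat12 ι K (relMatrix K s)) (i j p q : ι) :
    rel s (fun i p => Matrix.of fun j l => swapRows M (i, j) (p, l)) i j p q = 0 := by
  rw [rel, sub_eq_zero]
  ext a b
  have h1 := congrFun₂ h ((a, i), j) ((p, q), b)
  rw [mat23_mul_apply, mul_mat12_apply] at h1
  simp only [mat12_mul_mat23_apply] at h1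
  simp only [Matrix.sum_apply, Matrix.smul_apply, Matrix.mul_apply]
  simp only [Algebra.smul_def]
  exact h1.trans (Finset.sum_congr rfl fun x _ => Finset.sum_congr rfl fun y _ => mul_comm _ _)

end LegMatrices

/-! ### The matrices of an infinitesimally braided vector space -/

section Braided

variable {k V ι : Type*} [Field k] [AddCommGroup V] [Module k V] [Fintype ι] [DecidableEq ι]
  (b : Module.Basis ι k V)

/-- The matrix of an endomorphism, with the rows indexed by the source. -/
def rowMatrix {n W : Type*} [Fintype n] [DecidableEq n] [AddCommGroup W] [Module k W]
    (b : Module.Basis n k W) (f : Module.End k W) : Matrix n n k :=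
  (LinearMap.toMatrix b b f).transpose

/-- Indexing rows by the source matches the coefficients `f_{ij}^{pq}`, at the price of reversing
products. -/
lemma rowMatrix_mul {n W : Type*} [Fintype n] [DecidableEq n] [AddCommGroup W] [Module k W]
    (b : Module.Basis n k W) (f g : Module.End k W) :
    rowMatrix b (f * g) = rowMatrix b g * rowMatrix b f := by
  rw [rowMatrix, LinearMap.toMatrix_mul, Matrix.transpose_mul]
  rfl

lemma rowMatrix_add {n W : Type*} [Fintype n] [DecidableEq n] [AddCommGroup W] [Module k W]
    (b : Module.Basis n k W) (f g : Module.End k W) :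
    rowMatrix b (f + g) = rowMatrix b f + rowMatrix b g := by
  simp [rowMatrix]

lemma rowMatrix_apply {n W : Type*} [Fintype n] [DecidableEq n] [AddCommGroup W] [Module k W]
    (b : Module.Basis n k W) (f : Module.End k W) (x y : n) :
    rowMatrix b f x y = b.repr (f (b x)) y := by
  simp [rowMatrix, LinearMap.toMatrix_apply]

lemma coeff_eq_rowMatrix (f : Module.End k (V ⊗[k] V)) (i j p q : ι) :
    coeff b f i j p q = rowMatrix (b.tensorProduct b) f (i, j) (p, q) := by
  simp [coeff, rowMatrix_apply]

lemma rowMatrix_leg12 (f : Module.End k (V ⊗[k] V)) :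
    rowMatrix ((b.tensorProduct b).tensorProduct b) (leg12 f) =
      mat12 ι k (rowMatrix (b.tensorProduct b) f) := by
  ext ⟨⟨i, j⟩, l⟩ ⟨⟨p, q⟩, r⟩
  rw [mat12_apply, rowMatrix_apply, rowMatrix_apply]
  simp [leg12, Finsupp.single_apply]

lemma rowMatrix_leg23 (f : Module.End k (V ⊗[k] V)) :
    rowMatrix ((b.tensorProduct b).tensorProduct b) (leg23 f) =
      mat23 ι k (rowMatrix (b.tensorProduct b) f) := by
  ext ⟨⟨i, j⟩, l⟩ ⟨⟨p, q⟩, r⟩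
  have key : ∀ w : V ⊗[k] V, ((b.tensorProduct b).tensorProduct b).repr
      ((TensorProduct.assoc k V V V).symm (b i ⊗ₜ w)) ((p, q), r) =
        if i = p then (b.tensorProduct b).repr w (q, r) else 0 := by
    intro w
    induction w using TensorProduct.induction_on with
    | zero => simp
    | tmul x y => simp [Finsupp.single_apply]
    | add x y hx hy =>
      rw [TensorProduct.tmul_add, map_add, map_add, Finsupp.add_apply, hx, hy]
      split_ifs <;> simp
  rw [mat23_apply, rowMatrix_apply, rowMatrix_apply, ← key]
  simp [leg23]

end Braided

/-! ### First order deformations -/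

section Deformation

/-- The defining relations of `H`, tensored with a scalar of `K`; this is the form in which
quasi-commutativity on generators uses them. -/
lemma sum_algebraMap_tmul {k ι H K : Type*} [Field k] [Fintype ι] [Ring H] [Bialgebra k H]
    [CommRing K] [Algebra k K] {T : ι → ι → H} {s : ι → ι → ι → ι → k}
    (h : ∀ i j p q, rel s T i j p q = 0)
    (x : K) (i j p q : ι) :
    ∑ m, ∑ n, (x * algebraMap k K (s i j m n)) ⊗ₜ[k] (T m p * T n q) =
      ∑ m, ∑ n, (x * algebraMap k K (s m n p q)) ⊗ₜ[k] (T i m * T j n) := by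
  have h1 := congrArg (fun y => x ⊗ₜ[k] y) (sub_eq_zero.1 (h i j p q))
  simp only [TensorProduct.tmul_sum, ← TensorProduct.smul_tmul] at h1
  simpa only [Algebra.smul_def, mul_comm x] using h1

/-- A first order deformation of an intertwining relation. -/
lemma deform_intertwine {K A : Type*} [CommRing K] [Ring A] [Algebra K A] {e : K} (he : e * e = 0)
    {s s' X Y U W : A} (h₀ : s * (X * Y) = X * Y * s')
    (h₁ : s * (X * Y * W + X * U * Y) = (X * Y * W + X * U * Y) * s') :
    s * ((X + e • (X * U)) * (Y + e • (Y * W))) =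
      (X + e • (X * U)) * (Y + e • (Y * W)) * s' := by
  have hexp : (X + e • (X * U)) * (Y + e • (Y * W)) =
      X * Y + e • (X * Y * W + X * U * Y) := by
    simp only [add_mul, mul_add, smul_mul_assoc, mul_smul_comm, smul_smul, he, zero_smul,
      add_zero, smul_add, mul_assoc]
    abel
  rw [hexp, mul_add, add_mul, mul_smul_comm, smul_mul_assoc, h₀, h₁]

/-- The relations between the legs of an infinitesimally braided vector space. -/
structure LegRelations {A : Type*} [Ring A] (C₁₂ C₂₃ D₁₂ D₂₃ T₁₂ T₂₃ : A) : Prop where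
  inv₁₂ : C₁₂ * D₁₂ = 1
  inv₁₂' : D₁₂ * C₁₂ = 1
  inv₂₃ : C₂₃ * D₂₃ = 1
  inv₂₃' : D₂₃ * C₂₃ = 1
  braid : C₁₂ * C₂₃ * C₁₂ = C₂₃ * C₁₂ * C₂₃
  conj₁ : D₂₃ * T₁₂ * C₂₃ = C₁₂ * T₂₃ * D₁₂
  conj₂ : C₁₂ * T₂₃ * D₁₂ = C₂₃ * T₁₂ * D₂₃
  conj₃ : C₂₃ * T₁₂ * D₂₃ = D₁₂ * T₂₃ * C₁₂
  comm₁ : T₂₃ * T₁₂ + T₂₃ * (D₁₂ * T₂₃ * C₁₂) = T₁₂ * T₂₃ + D₁₂ * T₂₃ * C₁₂ * T₂₃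
  comm₂ : T₁₂ * T₂₃ + T₁₂ * (D₂₃ * T₁₂ * C₂₃) = T₂₃ * T₁₂ + D₂₃ * T₁₂ * C₂₃ * T₁₂

namespace LegRelations

variable {A : Type*} [Ring A] {C₁₂ C₂₃ D₁₂ D₂₃ T₁₂ T₂₃ : A}

/-- The relations are invariant under exchanging the two legs. -/
lemma symm (h : LegRelations C₁₂ C₂₃ D₁₂ D₂₃ T₁₂ T₂₃) :
    LegRelations C₂₃ C₁₂ D₂₃ D₁₂ T₂₃ T₁₂ where
  inv₁₂ := h.inv₂₃
  inv₁₂' := h.inv₂₃'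
  inv₂₃ := h.inv₁₂
  inv₂₃' := h.inv₁₂'
  braid := h.braid.symm
  conj₁ := h.conj₃.symm
  conj₂ := h.conj₂.symm
  conj₃ := h.conj₁.symm
  comm₁ := h.comm₂
  comm₂ := h.comm₁

lemma map {B : Type*} [Ring B] (φ : A →+* B) (h : LegRelations C₁₂ C₂₃ D₁₂ D₂₃ T₁₂ T₂₃) :
    LegRelations (φ C₁₂) (φ C₂₃) (φ D₁₂) (φ D₂₃) (φ T₁₂) (φ T₂₃) := by
  constructor <;> simp only [← map_mul, ← map_add, h.inv₁₂, h.inv₁₂', h.inv₂₃, h.inv₂₃', map_one]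
  exacts [congrArg φ h.braid, congrArg φ h.conj₁, congrArg φ h.conj₂, congrArg φ h.conj₃,
    congrArg φ h.comm₁, congrArg φ h.comm₂]

/-- A rearrangement of `D₂₃T₁₂C₂₃ = C₁₂T₂₃D₁₂`. It is the order zero part of the relation for `t`,
as the braid relation is for `c`. -/
lemma intertwine_t (h : LegRelations C₁₂ C₂₃ D₁₂ D₂₃ T₁₂ T₂₃) :
    T₁₂ * (C₂₃ * C₁₂) = C₂₃ * C₁₂ * T₂₃ := by
  have h1 : D₂₃ * T₁₂ * C₂₃ * C₁₂ = C₁₂ * T₂₃ := by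
    rw [h.conj₁, mul_assoc, h.inv₁₂', mul_one]
  calc T₁₂ * (C₂₃ * C₁₂) = C₂₃ * D₂₃ * T₁₂ * (C₂₃ * C₁₂) := by rw [h.inv₂₃, one_mul]
    _ = C₂₃ * (D₂₃ * T₁₂ * C₂₃ * C₁₂) := by simp only [mul_assoc]
    _ = _ := by rw [h1, mul_assoc]

/-- Writes the first order part of the deformed `C₂₃C₁₂` as `C₂₃C₁₂Ω`, with `Ω = T₁₂ + D₁₂T₂₃C₁₂`.
-/
lemma middle (h : LegRelations C₁₂ C₂₃ D₁₂ D₂₃ T₁₂ T₂₃) :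
    C₂₃ * C₁₂ * T₁₂ + C₂₃ * T₂₃ * C₁₂ = C₂₃ * C₁₂ * (T₁₂ + D₁₂ * T₂₃ * C₁₂) := by
  rw [mul_add]
  congr 1
  calc C₂₃ * T₂₃ * C₁₂ = C₂₃ * (C₁₂ * D₁₂) * T₂₃ * C₁₂ := by rw [h.inv₁₂, mul_one]
    _ = _ := by simp only [mul_assoc]

lemma commute_t (h : LegRelations C₁₂ C₂₃ D₁₂ D₂₃ T₁₂ T₂₃) :
    T₂₃ * (T₁₂ + D₁₂ * T₂₃ * C₁₂) = (T₁₂ + D₁₂ * T₂₃ * C₁₂) * T₂₃ := by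
  rw [mul_add, add_mul, h.comm₁]

/-- Conjugation by `C₂₃` exchanges the two summands, since `D₁₂T₂₃C₁₂` equals both `C₂₃T₁₂D₂₃` and
`D₂₃T₁₂C₂₃`. -/
lemma commute_c (h : LegRelations C₁₂ C₂₃ D₁₂ D₂₃ T₁₂ T₂₃) :
    C₂₃ * (T₁₂ + D₁₂ * T₂₃ * C₁₂) = (T₁₂ + D₁₂ * T₂₃ * C₁₂) * C₂₃ := by
  have h1 : C₂₃ * T₁₂ = D₁₂ * T₂₃ * C₁₂ * C₂₃ := by
    rw [← h.conj₃, mul_assoc, h.inv₂₃', mul_one]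
  have h2 : C₂₃ * (D₁₂ * T₂₃ * C₁₂) = T₁₂ * C₂₃ := by
    rw [← h.conj₃, ← h.conj₂, ← h.conj₁, ← mul_assoc, ← mul_assoc, h.inv₂₃, one_mul]
  rw [mul_add, add_mul, h1, h2, add_comm]

variable {K : Type*} [CommRing K] [Algebra K A] {e : K}

/-- The braid relation moves `C₁₂` past `C₂₃C₁₂`, turning it into `C₂₃`, which commutes with `Ω` by
`commute_c`. -/
lemma deform_c (h : LegRelations C₁₂ C₂₃ D₁₂ D₂₃ T₁₂ T₂₃) (he : e * e = 0) :
    C₁₂ * ((C₂₃ + e • (C₂₃ * T₂₃)) * (C₁₂ + e • (C₁₂ * T₁₂))) =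
      (C₂₃ + e • (C₂₃ * T₂₃)) * (C₁₂ + e • (C₁₂ * T₁₂)) * C₂₃ := by
  refine deform_intertwine he (by rw [← mul_assoc, h.braid]) ?_
  rw [h.middle, ← mul_assoc C₁₂, ← mul_assoc C₁₂, h.braid, mul_assoc (C₂₃ * C₁₂) C₂₃, h.commute_c,
    ← mul_assoc]

/-- As in `deform_c`, with `intertwine_t` and `commute_t` in place of the braid relation and
`commute_c`. -/
lemma deform_t (h : LegRelations C₁₂ C₂₃ D₁₂ D₂₃ T₁₂ T₂₃) (he : e * e = 0) :
    T₁₂ * ((C₂₃ + e • (C₂₃ * T₂₃)) * (C₁₂ + e • (C₁₂ * T₁₂))) =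
      (C₂₃ + e • (C₂₃ * T₂₃)) * (C₁₂ + e • (C₁₂ * T₁₂)) * T₂₃ := by
  refine deform_intertwine he h.intertwine_t ?_
  rw [h.middle, ← mul_assoc, h.intertwine_t, mul_assoc (C₂₃ * C₁₂) T₂₃, h.commute_t, ← mul_assoc]

end LegRelations

variable {k V ι : Type*} [Field k] [AddCommGroup V] [Module k V] [Fintype ι] [DecidableEq ι]
  (b : Module.Basis ι k V)

/-- The matrix of `f`, with coefficients in a `k`-algebra. -/
def coeffMatrix (K : Type*) [CommRing K] [Algebra k K] (f : Module.End k (V ⊗[k] V)) :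
    Matrix (ι × ι) (ι × ι) K :=
  relMatrix K (coeff b f)

lemma coeffMatrix_eq_map {K : Type*} [CommRing K] [Algebra k K] (f : Module.End k (V ⊗[k] V)) :
    coeffMatrix b K f = (rowMatrix (b.tensorProduct b) f).map (algebraMap k K) := by
  ext ⟨i, j⟩ ⟨p, q⟩
  simp [coeffMatrix, relMatrix, coeff_eq_rowMatrix]

lemma coeffMatrix_mul {K : Type*} [CommRing K] [Algebra k K] (f g : Module.End k (V ⊗[k] V)) :
    coeffMatrix b K (f * g) = coeffMatrix b K g * coeffMatrix b K f := by
  simp [coeffMatrix_eq_map, rowMatrix_mul, Matrix.map_mul]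

lemma coeffMatrix_one {K : Type*} [CommRing K] [Algebra k K] :
    coeffMatrix b K (1 : Module.End k (V ⊗[k] V)) = 1 := by
  simp [coeffMatrix_eq_map, rowMatrix]

lemma IsInfinitesimallyBraided.legRelations {c : (V ⊗[k] V) ≃ₗ[k] (V ⊗[k] V)}
    {t : Module.End k (V ⊗[k] V)} (h : IsInfinitesimallyBraided c t)
    (K : Type*) [CommRing K] [Algebra k K] :
    LegRelations (mat12 ι K (coeffMatrix b K c.toLinearMap))
      (mat23 ι K (coeffMatrix b K c.toLinearMap)) (mat12 ι K (coeffMatrix b K c.symm.toLinearMap))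
      (mat23 ι K (coeffMatrix b K c.symm.toLinearMap)) (mat12 ι K (coeffMatrix b K t))
      (mat23 ι K (coeffMatrix b K t)) := by
  have hcd : c.toLinearMap * c.symm.toLinearMap = (1 : Module.End k (V ⊗[k] V)) :=
    LinearMap.ext c.apply_symm_apply
  have hdc : c.symm.toLinearMap * c.toLinearMap = (1 : Module.End k (V ⊗[k] V)) :=
    LinearMap.ext c.symm_apply_apply
  have h1 := (coeffMatrix_mul b (K := k) _ _).symm.trans
    ((congrArg (coeffMatrix b k) hcd).trans (coeffMatrix_one b))
  have h2 := (coeffMatrix_mul b (K := k) _ _).symm.trans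
    ((congrArg (coeffMatrix b k) hdc).trans (coeffMatrix_one b))
  have hmap : ∀ f : Module.End k (V ⊗[k] V), coeffMatrix b k f = rowMatrix (b.tensorProduct b) f :=
    fun f => by
      rw [coeffMatrix_eq_map]
      ext; simp
  have key : LegRelations (mat12 ι k (coeffMatrix b k c.toLinearMap))
      (mat23 ι k (coeffMatrix b k c.toLinearMap)) (mat12 ι k (coeffMatrix b k c.symm.toLinearMap))
      (mat23 ι k (coeffMatrix b k c.symm.toLinearMap)) (mat12 ι k (coeffMatrix b k t))
      (mat23 ι k (coeffMatrix b k t)) := by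
    have hrow : ∀ {f g : Module.End k ((V ⊗[k] V) ⊗[k] V)}, f = g →
        rowMatrix ((b.tensorProduct b).tensorProduct b) f =
          rowMatrix ((b.tensorProduct b).tensorProduct b) g := fun h => congrArg _ h
    -- Passing to row-indexed matrices reverses all products, so each operator axiom turns into the
    -- corresponding field of `LegRelations` read backwards.
    have e0 := hrow h.braid
    have e1 := hrow h.conj₁
    have e2 := hrow h.conj₂
    have e3 := hrow h.conj₃
    have e4 := hrow h.comm₁
    have e5 := hrow h.comm₂
    simp only [rowMatrix_mul, rowMatrix_add, rowMatrix_leg12, rowMatrix_leg23,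
      ← hmap] at e0 e1 e2 e3 e4 e5
    constructor
    · rw [← map_mul, h2, map_one]
    · rw [← map_mul, h1, map_one]
    · rw [← map_mul, h2, map_one]
    · rw [← map_mul, h1, map_one]
    · simpa only [mul_assoc] using e0
    · simpa only [mul_assoc] using e1
    · simpa only [mul_assoc] using e2
    · simpa only [mul_assoc] using e3
    · simpa only [mul_assoc] using e4
    · simpa only [mul_assoc] using e5
  -- The relations are proved over `k` and transported to `K` by base change of matrices.
  have := key.map (algebraMap k K).mapMatrix
  simpa only [RingHom.mapMatrix_apply, hmap, ← mat12_map, ← mat23_map, ← coeffMatrix_eq_map]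
    using this

/-- The matrix of `c (1 + e t)`, in the convention where rows are indexed by the source. -/
def deformedMatrix {K : Type*} [CommRing K] [Algebra k K] (e : K)
    (c t : Module.End k (V ⊗[k] V)) : Matrix (ι × ι) (ι × ι) K :=
  coeffMatrix b K c + e • (coeffMatrix b K c * coeffMatrix b K t)

variable {H K : Type*} [Ring H] [Bialgebra k H] [CommRing K] [Algebra k K]
  {S : Set (ι → ι → ι → ι → k)} {T : ι → ι → H}

/-- Endomorphisms whose relations hold in `H` are closed under composition, because their matrices
all lie in the commutant of one matrix. -/
lemma rel_coeff_mul {f g : Module.End k (V ⊗[k] V)}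
    (hf : ∀ i j p q, rel (coeff b f) T i j p q = 0)
    (hg : ∀ i j p q, rel (coeff b g) T i j p q = 0) (i j p q : ι) :
    rel (coeff b (f * g)) T i j p q = 0 := by
  refine (rel_eq_zero_iff _ _).2 ?_ i j p q
  have : relMatrix H (coeff b (f * g)) = relMatrix H (coeff b g) * relMatrix H (coeff b f) := by
    ext ⟨i, j⟩ ⟨p, q⟩
    have h1 := congrFun₂ (coeffMatrix_mul b (K := k) f g) (i, j) (p, q)
    simp only [Matrix.mul_apply, coeffMatrix, relMatrix, Matrix.of_apply, Algebra.algebraMap_self,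
      RingHom.id_apply] at h1
    simp [Matrix.mul_apply, relMatrix, h1]
  rw [this]
  exact ((rel_eq_zero_iff _ _).1 hg).mul_left ((rel_eq_zero_iff _ _).1 hf)

/-- The bicharacter attached to a first order deformation of `c` along `t`. -/
theorem IsInfinitesimallyBraided.exists_bicharacter {c : (V ⊗[k] V) ≃ₗ[k] (V ⊗[k] V)}
    {t : Module.End k (V ⊗[k] V)} (h : IsInfinitesimallyBraided c t) (hT : IsPresentation S T)
    (hS : ∀ s ∈ S, s = coeff b c.toLinearMap ∨ s = coeff b t)
    (hc : ∀ i j p q, rel (coeff b c.toLinearMap) T i j p q = 0)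
    (ht : ∀ i j p q, rel (coeff b t) T i j p q = 0) {e : K} (he : e * e = 0) :
    ∃ R : (WithConv (H ⊗[k] H →ₗ[k] K))ˣ, IsBicharacter R.val ∧ IsQuasiCommutative R.val ∧
      ∀ i j p q, R.val.ofConv (T i p ⊗ₜ T j q) =
        deformedMatrix b e c.toLinearMap t (j, i) (p, q) := by
  have hleg := h.legRelations b K
  have hcd : coeffMatrix b K c.toLinearMap * coeffMatrix b K c.symm.toLinearMap = 1 := by
    rw [← coeffMatrix_mul, ← coeffMatrix_one b]
    exact congrArg _ (LinearMap.ext c.symm_apply_apply)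
  have hdc : coeffMatrix b K c.symm.toLinearMap * coeffMatrix b K c.toLinearMap = 1 := by
    rw [← coeffMatrix_mul, ← coeffMatrix_one b]
    exact congrArg _ (LinearMap.ext c.apply_symm_apply)
  have hte : (1 + e • coeffMatrix b K t) * (1 - e • coeffMatrix b K t) = 1 := by
    simp [mul_sub, add_mul, smul_smul, he]
  have hte' : (1 - e • coeffMatrix b K t) * (1 + e • coeffMatrix b K t) = 1 := by
    simp [sub_mul, mul_add, smul_smul, smul_sub, he]
  have hdef : deformedMatrix b e c.toLinearMap t =
      coeffMatrix b K c.toLinearMap * (1 + e • coeffMatrix b K t) := by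
    simp [deformedMatrix, mul_add]
  -- Since `e² = 0`, the inverse of `1 + eT` is `1 - eT`, so `D` is the inverse of `C(1 + eT)`.
  let D := (1 - e • coeffMatrix b K t) * coeffMatrix b K c.symm.toLinearMap
  have hM : deformedMatrix b e c.toLinearMap t * D = 1 := by
    rw [hdef, mul_assoc, ← mul_assoc _ _ (coeffMatrix b K c.symm.toLinearMap), hte, one_mul, hcd]
  have hM' : D * deformedMatrix b e c.toLinearMap t = 1 := by
    rw [hdef, mul_assoc, ← mul_assoc (coeffMatrix b K c.symm.toLinearMap), hdc, one_mul, hte']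
  have h12 : mat12 ι K (deformedMatrix b e c.toLinearMap t) =
      mat12 ι K (coeffMatrix b K c.toLinearMap) + e • (mat12 ι K (coeffMatrix b K c.toLinearMap) *
        mat12 ι K (coeffMatrix b K t)) := by
    simp only [deformedMatrix, map_add, map_smul, map_mul]
  have h23 : mat23 ι K (deformedMatrix b e c.toLinearMap t) =
      mat23 ι K (coeffMatrix b K c.toLinearMap) + e • (mat23 ι K (coeffMatrix b K c.toLinearMap) *
        mat23 ι K (coeffMatrix b K t)) := by
    simp only [deformedMatrix, map_add, map_smul, map_mul]
  -- The rows are swapped because `R(T_i^p ⊗ T_j^q)` is prescribed by `c_{ji}^{pq}`.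
  refine hT.exists_bicharacter (swapRows_mul hM) (mul_swapRows hM') (fun s hs => rel_op_block ?_)
    (fun s hs => rel_left ?_) fun i j p q => ?_
  · rw [h12, h23]
    rcases hS s hs with rfl | rfl
    exacts [hleg.deform_c he, hleg.deform_t he]
  · rw [h12, h23]
    rcases hS s hs with rfl | rfl
    -- The relations in the first argument come from those in the second by exchanging the legs,
    -- which brings in the other commutator axiom.
    exacts [hleg.symm.deform_c he, hleg.symm.deform_t he]
  · have hval : ∀ i j p q, deformedMatrix b e c.toLinearMap t (i, j) (p, q) =
        1 * algebraMap k K (coeff b c.toLinearMap i j p q) +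
          e * algebraMap k K (coeff b (t * c.toLinearMap) i j p q) := fun i j p q => by
      rw [deformedMatrix, ← coeffMatrix_mul, one_mul]
      rfl
    -- Quasi-commutativity on generators is the relation of `H` for `c + e (t ∘ c)`; it follows from
    -- those for `c` and, by `rel_coeff_mul`, for `t ∘ c`.
    have e1 := sum_algebraMap_tmul (K := K) hc 1 j i p q
    have e2 := sum_algebraMap_tmul (K := K) (rel_coeff_mul b ht hc) e j i p q
    rw [Finset.sum_comm (f := fun m n =>
      swapRows (deformedMatrix b e c.toLinearMap t) (m, n) (p, q) ⊗ₜ[k] (T j n * T i m))]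
    simp only [swapRows, Matrix.submatrix_apply, Prod.swap_prod_mk, id_eq, hval,
      TensorProduct.add_tmul, Finset.sum_add_distrib]
    rw [e1, e2]

end Deformation

/-! ### Forms with values in the dual numbers -/

section DualNumber

variable {k C : Type*} [Field k] [AddCommGroup C] [Module k C] [Coalgebra k C]

/-- The constant term of a form with values in the dual numbers. -/
def fstForm (f : WithConv (C →ₗ[k] DualNumber k)) : WithConv (C →ₗ[k] k) :=
  push (TrivSqZeroExt.fstHom k k k) f

/-- The infinitesimal term of a form with values in the dual numbers. -/
def sndForm (f : WithConv (C →ₗ[k] DualNumber k)) : WithConv (C →ₗ[k] k) :=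
  toConv (TrivSqZeroExt.sndHom k k ∘ₗ f.ofConv)

/-- The form `f + ε g`. -/
def dualForm (f g : WithConv (C →ₗ[k] k)) : WithConv (C →ₗ[k] DualNumber k) :=
  toConv ((TrivSqZeroExt.inlAlgHom k k k).toLinearMap ∘ₗ f.ofConv +
    TrivSqZeroExt.inrHom k k ∘ₗ g.ofConv)

lemma fstForm_apply (f : WithConv (C →ₗ[k] DualNumber k)) (x : C) :
    (fstForm f).ofConv x = (f.ofConv x).fst := rfl

lemma sndForm_apply (f : WithConv (C →ₗ[k] DualNumber k)) (x : C) :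
    (sndForm f).ofConv x = (f.ofConv x).snd := rfl

@[simp] lemma fstForm_dualForm (f g : WithConv (C →ₗ[k] k)) : fstForm (dualForm f g) = f := by
  ext x
  simp [fstForm_apply, dualForm]

@[simp] lemma sndForm_dualForm (f g : WithConv (C →ₗ[k] k)) : sndForm (dualForm f g) = g := by
  ext x
  simp [sndForm_apply, dualForm]

lemma dual_ext {f g : WithConv (C →ₗ[k] DualNumber k)} (h₁ : fstForm f = fstForm g)
    (h₂ : sndForm f = sndForm g) : f = g := by
  ext x
  · rw [← fstForm_apply, h₁, fstForm_apply]
  · rw [← sndForm_apply, h₂, sndForm_apply]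

lemma fstForm_mul (f g : WithConv (C →ₗ[k] DualNumber k)) :
    fstForm (f * g) = fstForm f * fstForm g :=
  map_mul (push (TrivSqZeroExt.fstHom k k k)) f g

lemma fstForm_one : fstForm (1 : WithConv (C →ₗ[k] DualNumber k)) = 1 :=
  map_one (push (TrivSqZeroExt.fstHom k k k))

lemma sndForm_mul (f g : WithConv (C →ₗ[k] DualNumber k)) :
    sndForm (f * g) = fstForm f * sndForm g + sndForm f * fstForm g := by
  ext x
  rw [sndForm_apply, (ℛ k x).convMul_apply, ofConv_add, LinearMap.add_apply,
    (ℛ k x).convMul_apply, (ℛ k x).convMul_apply, ← Finset.sum_add_distrib,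
    TrivSqZeroExt.snd_sum]
  refine Finset.sum_congr rfl fun i _ => ?_
  simp [fstForm_apply, sndForm_apply, mul_comm]

lemma sndForm_one : sndForm (1 : WithConv (C →ₗ[k] DualNumber k)) = 0 := by
  ext x
  simp [sndForm_apply, TrivSqZeroExt.algebraMap_eq_inl]

/-- The inverse of `u + εg` is `u⁻¹ - ε u⁻¹gu⁻¹`. -/
lemma isUnit_dualForm (u : (WithConv (C →ₗ[k] k))ˣ) (g : WithConv (C →ₗ[k] k)) :
    IsUnit (dualForm (u : WithConv (C →ₗ[k] k)) g) := by
  have hr : ∀ x y : WithConv (C →ₗ[k] k), x * -y = -(x * y) := fun x y => mul_neg x y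
  have hl : ∀ x y : WithConv (C →ₗ[k] k), -x * y = -(x * y) := fun x y => neg_mul x y
  have h₁ : dualForm u.val g * dualForm u⁻¹.val (-(u⁻¹.val * g * u⁻¹.val)) = 1 :=
    dual_ext (by simp [fstForm_mul, fstForm_one])
      (by simp [sndForm_mul, sndForm_one, mul_assoc, hr])
  have h₂ : dualForm u⁻¹.val (-(u⁻¹.val * g * u⁻¹.val)) * dualForm u.val g = 1 :=
    dual_ext (by simp [fstForm_mul, fstForm_one])
      (by simp [sndForm_mul, sndForm_one, mul_assoc, hl])
  exact ⟨⟨_, _, h₁, h₂⟩, rfl⟩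

end DualNumber

/-! ### Infinitesimal forms as first order deformations -/

section Infinitesimal

variable {k H : Type*} [Field k] [Ring H] [Bialgebra k H]

lemma fstForm_legL (f : WithConv (H ⊗[k] H →ₗ[k] DualNumber k)) (a : H) :
    fstForm (legL f a) = legL (fstForm f) a := rfl

lemma sndForm_legL (f : WithConv (H ⊗[k] H →ₗ[k] DualNumber k)) (a : H) :
    sndForm (legL f a) = legL (sndForm f) a := rfl

lemma fstForm_legR (f : WithConv (H ⊗[k] H →ₗ[k] DualNumber k)) (a : H) :
    fstForm (legR f a) = legR (fstForm f) a := rfl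

lemma sndForm_legR (f : WithConv (H ⊗[k] H →ₗ[k] DualNumber k)) (a : H) :
    sndForm (legR f a) = legR (sndForm f) a := rfl

lemma IsBicharacter.fstForm {f : WithConv (H ⊗[k] H →ₗ[k] DualNumber k)} (hf : IsBicharacter f) :
    IsBicharacter (fstForm f) where
  mul_left a b := by simp only [← fstForm_legL, hf.mul_left, fstForm_mul]
  mul_right a b := by simp only [← fstForm_legR, hf.mul_right, fstForm_mul]
  one_left := by rw [← fstForm_legL, hf.one_left, fstForm_one]
  one_right := by rw [← fstForm_legR, hf.one_right, fstForm_one]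

/-- The right side is the coefficient of `ε` in the multiplicativity of `f + εg` in the first
argument. -/
lemma formMulLeft_eq_add_iff (f g : ConvForm k H) :
    formMulLeft g = form13 f * form23 g + form13 g * form23 f ↔
      ∀ a b, legL g (a * b) = legL f a * legL g b + legL g a * legL f b := by
  refine ⟨fun h a b => ?_, fun h => form_ext₃ fun a b c => ?_⟩
  · ext c
    rw [ofConv_add, LinearMap.add_apply, ← form13_mul_form23_apply, ← form13_mul_form23_apply,
      ← formMulLeft_apply, h]
    rfl
  · rw [ofConv_add, LinearMap.add_apply, form13_mul_form23_apply, form13_mul_form23_apply,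
      formMulLeft_apply, h]
    rfl

lemma formMulRight_eq_add_iff (f g : ConvForm k H) :
    formMulRight g = form13 f * form12 g + form13 g * form12 f ↔
      ∀ b c, legR g (b * c) = legR f c * legR g b + legR g c * legR f b := by
  refine ⟨fun h b c => ?_, fun h => form_ext₃ fun a b c => ?_⟩
  · ext a
    rw [ofConv_add, LinearMap.add_apply, ← form13_mul_form12_apply, ← form13_mul_form12_apply,
      ← formMulRight_apply, h]
    rfl
  · rw [ofConv_add, LinearMap.add_apply, form13_mul_form12_apply, form13_mul_form12_apply,
      formMulRight_apply, h]
    rfl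

/-- Pullback along the multiplication is an algebra map, so the left side is `R₁₃R₂₃` times `χ(m ⊗
Id)`. Cancelling the unit `R₁₃R₂₃` leaves `χ₂₃ + R₂₃⁻¹χ₁₃R₂₃` on the right. -/
lemma formMulLeft_mul_iff {R : (ConvForm k H)ˣ} (hR : IsCoquasitriangular R) (χ : ConvForm k H) :
    formMulLeft (R.val * χ) = form13 R.val * form23 (R.val * χ) +
        form13 (R.val * χ) * form23 R.val ↔
      formMulLeft χ = form23 χ +
        form23 ((R⁻¹ : (ConvForm k H)ˣ) : ConvForm k H) * form13 χ * form23 R.val := by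
  have h := hR.mul_left
  simp only [formMulLeft_eq_pull, form13_eq_pull, form23_eq_pull, map_mul] at h ⊢
  have hu : IsUnit (pull (hom13 k H) R.val * pull (hom23 k H) R.val) :=
    (R.isUnit.map (pull (hom13 k H))).mul (R.isUnit.map (pull (hom23 k H)))
  have h1 : pull (hom23 k H) R.val * pull (hom23 k H) R⁻¹.val = 1 := by
    rw [← map_mul, Units.mul_inv, map_one]
  rw [h, ← hu.mul_right_inj (b := pull (mulLeftHom k H) χ), mul_add]
  simp only [mul_assoc]
  rw [← mul_assoc (pull (hom23 k H) R.val) (pull (hom23 k H) R⁻¹.val), h1, one_mul]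

lemma formMulRight_mul_iff {R : (ConvForm k H)ˣ} (hR : IsCoquasitriangular R) (χ : ConvForm k H) :
    formMulRight (R.val * χ) = form13 R.val * form12 (R.val * χ) +
        form13 (R.val * χ) * form12 R.val ↔
      formMulRight χ = form12 χ +
        form12 ((R⁻¹ : (ConvForm k H)ˣ) : ConvForm k H) * form13 χ * form12 R.val := by
  have h := hR.mul_right
  simp only [formMulRight_eq_pull, form13_eq_pull, form12_eq_pull, map_mul] at h ⊢
  have hu : IsUnit (pull (hom13 k H) R.val * pull (hom12 k H) R.val) :=
    (R.isUnit.map (pull (hom13 k H))).mul (R.isUnit.map (pull (hom12 k H)))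
  have h1 : pull (hom12 k H) R.val * pull (hom12 k H) R⁻¹.val = 1 := by
    rw [← map_mul, Units.mul_inv, map_one]
  rw [h, ← hu.mul_right_inj (b := pull (mulRightHom k H) χ), mul_add]
  simp only [mul_assoc]
  rw [← mul_assoc (pull (hom12 k H) R.val) (pull (hom12 k H) R⁻¹.val), h1, one_mul]

lemma unitForm_eq_push (f : ConvForm k H) : unitForm f = push (Algebra.ofId k H) f := rfl

lemma IsBicharacter.isCoquasitriangular {R : (ConvForm k H)ˣ} (hR : IsBicharacter R.val)
    (hq : IsQuasiCommutative R.val) : IsCoquasitriangular R where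
  quasi_comm := hq.unitForm_mul LinearMap.id
  mul_right := (formMulRight_eq_iff _).2 hR.mul_right
  mul_left := (formMulLeft_eq_iff _).2 hR.mul_left

/-- A first order deformation of `R` defines an infinitesimal `R`-form. -/
lemma IsCoquasitriangular.isInfinitesimalRForm {R : (ConvForm k H)ˣ} (hR : IsCoquasitriangular R)
    {f : WithConv (H ⊗[k] H →ₗ[k] DualNumber k)} (hf : IsBicharacter f)
    (hq : IsQuasiCommutative f) (hfR : fstForm f = R.val) :
    IsInfinitesimalRForm R (↑R⁻¹ * sndForm f) := by
  have hmul : R.val * (↑R⁻¹ * sndForm f) = sndForm f := by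
    rw [← mul_assoc, Units.mul_inv, one_mul]
  refine ⟨?_, (formMulRight_mul_iff hR _).1 ?_, (formMulLeft_mul_iff hR _).1 ?_⟩
  · have h1 := hq.unitForm_mul (TrivSqZeroExt.sndHom k k)
    change unitForm (sndForm f) * convMult k H = convMultOp k H * unitForm (sndForm f) at h1
    have h2 := hR.quasi_comm
    rw [← hmul] at h1
    simp only [unitForm_eq_push, map_mul] at h1 h2 ⊢
    -- After multiplication by the unit `R`, the quasi-commutativity of `R * χ` moves the product
    -- through both factors and that of `R` moves it back past `R`.
    rw [← (R.isUnit.map (push (Algebra.ofId k H))).mul_right_inj]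
    simp only [mul_assoc] at h1 ⊢
    rw [h1, ← mul_assoc (convMultOp k H), ← h2]
    simp only [mul_assoc]
  · rw [hmul, formMulRight_eq_add_iff]
    intro b c
    rw [← sndForm_legR, hf.mul_right, sndForm_mul, fstForm_legR, fstForm_legR, hfR]
    rfl
  · rw [hmul, formMulLeft_eq_add_iff]
    intro a b
    rw [← sndForm_legL, hf.mul_left, sndForm_mul, fstForm_legL, fstForm_legL, hfR]
    rfl

/-- An infinitesimal `R`-form defines a first order deformation of `R`. -/
lemma IsInfinitesimalRForm.isBicharacter {R : (ConvForm k H)ˣ} (hR : IsCoquasitriangular R)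
    {χ : ConvForm k H} (hχ : IsInfinitesimalRForm R χ) :
    IsBicharacter (dualForm R.val (R.val * χ)) := by
  have hl := (formMulLeft_eq_add_iff _ _).1 ((formMulLeft_mul_iff hR χ).2 hχ.mul_left)
  have hr := (formMulRight_eq_add_iff _ _).1 ((formMulRight_mul_iff hR χ).2 hχ.mul_right)
  refine isBicharacter_of_isUnit (isUnit_dualForm R _) (fun a b => dual_ext ?_ ?_)
    fun b c => dual_ext ?_ ?_
  · simp only [fstForm_mul, fstForm_legL, fstForm_dualForm, hR.isBicharacter.mul_left]
  · simp only [sndForm_mul, fstForm_legL, sndForm_legL, fstForm_dualForm, sndForm_dualForm, hl]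
  · simp only [fstForm_mul, fstForm_legR, fstForm_dualForm, hR.isBicharacter.mul_right]
  · simp only [sndForm_mul, fstForm_legR, sndForm_legR, fstForm_dualForm, sndForm_dualForm, hr]

lemma IsBicharacter.pull {H' : Type*} [Ring H'] [Bialgebra k H'] (φ : H →ₐc[k] H')
    {f : ConvForm k H'} (hf : IsBicharacter f) :
    IsBicharacter (InfFRT.pull
      (Coalgebra.TensorProduct.map (φ : H →ₗc[k] H') (φ : H →ₗc[k] H')) f) := by
  have hl : ∀ a, legL (InfFRT.pull (Coalgebra.TensorProduct.map (φ : H →ₗc[k] H')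
      (φ : H →ₗc[k] H')) f) a = InfFRT.pull (φ : H →ₗc[k] H') (legL f (φ a)) := fun a => rfl
  have hr : ∀ a, legR (InfFRT.pull (Coalgebra.TensorProduct.map (φ : H →ₗc[k] H')
      (φ : H →ₗc[k] H')) f) a = InfFRT.pull (φ : H →ₗc[k] H') (legR f (φ a)) := fun a => rfl
  constructor
  · intro a b
    rw [hl, hl, hl, map_mul, hf.mul_left, map_mul]
  · intro a b
    rw [hr, hr, hr, map_mul, hf.mul_right, map_mul]
  · rw [hl, map_one, hf.one_left, map_one]
  · rw [hr, map_one, hf.one_right, map_one]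

end Infinitesimal

/-! ### Values on generators -/

section Generators

variable {k ι H : Type*} [Field k] [Fintype ι] [DecidableEq ι] [Ring H] [Bialgebra k H]
  {S : Set (ι → ι → ι → ι → k)} {T : ι → ι → H}

/-- The matrix of values of a form on generators. -/
def genMatrix (T : ι → ι → H) (f : ConvForm k H) : Matrix (ι × ι) (ι × ι) k :=
  .of fun x y => f.ofConv (T x.1 y.1 ⊗ₜ T x.2 y.2)

/-- Holds because the `T_i^j` form a matrix coalgebra. It lets `χ` be recovered on generators by
inverting the matrix of `R`. -/
lemma IsPresentation.genMatrix_mul (hT : IsPresentation S T) (f g : ConvForm k H) :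
    genMatrix T (f * g) = genMatrix T f * genMatrix T g := by
  ext ⟨i, j⟩ ⟨p, q⟩
  simp only [genMatrix, Matrix.of_apply, convMul_tmul f g (hT.repr i p) (hT.repr j q),
    Matrix.mul_apply, Fintype.sum_prod_type]
  rfl

lemma IsPresentation.genMatrix_one (hT : IsPresentation S T) :
    genMatrix T (1 : ConvForm k H) = 1 := by
  ext ⟨i, j⟩ ⟨p, q⟩
  by_cases h : i = p <;> by_cases h' : j = q <;>
    simp [genMatrix, hT.counit, Matrix.one_apply, h, h']

/-- An infinitesimal `R`-form is determined by its values on generators. -/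
lemma IsPresentation.infinitesimalRForm_ext (hT : IsPresentation S T) {R : (ConvForm k H)ˣ}
    (hR : IsCoquasitriangular R) {χ χ' : ConvForm k H} (hχ : IsInfinitesimalRForm R χ)
    (hχ' : IsInfinitesimalRForm R χ') (h : genMatrix T χ = genMatrix T χ') : χ = χ' := by
  have h1 : genMatrix T (R.val * χ) = genMatrix T (R.val * χ') := by
    rw [hT.genMatrix_mul, hT.genMatrix_mul, h]
  -- The deformations `R + ε(R * χ)` and `R + ε(R * χ')` are bicharacters agreeing on generators;
  -- the invertibility of `R` then gives `χ = χ'`.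
  have h2 := hT.bicharacter_ext (hχ.isBicharacter hR) (hχ'.isBicharacter hR) fun i j p q => by
    have h3 := congrFun₂ h1 (i, j) (p, q)
    simp only [genMatrix, Matrix.of_apply] at h3
    simp [dualForm, h3]
  have h3 := congrArg sndForm h2
  rwa [sndForm_dualForm, sndForm_dualForm, Units.mul_right_inj] at h3

end Generators

/-! ### The presentations of `A(c)` and `A(c,t)` -/

section FRT

variable {k V ι : Type*} [Field k] [AddCommGroup V] [Module k V] [Fintype ι] [DecidableEq ι]
  (b : Module.Basis ι k V) (c t : Module.End k (V ⊗[k] V))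

lemma liftF_genFRT (x : F k ι) :
    liftF (k := k) (genFRT b c) x = Ideal.Quotient.mkₐ k (relIdeal (coeff b c) (genF k)) x :=
  DFunLike.congr_fun (algHomF_ext fun i j => by simp [genFRT]) x

lemma isPresentation_genFRT : IsPresentation {coeff b c} (genFRT b c) where
  comul := comul_genFRT b c
  counit := counit_genFRT b c
  surjective x := by
    obtain ⟨y, rfl⟩ := Ideal.Quotient.mk_surjective x
    exact ⟨y, liftF_genFRT b c y⟩
  rel_eq_zero := by
    rintro s rfl i j p q
    have := Ideal.Quotient.eq_zero_iff_mem.2 (rel_mem (coeff b c) (genF k) i j p q)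
    exact (map_rel _ _ (Ideal.Quotient.mkₐ k (relIdeal (coeff b c) (genF k))) i j p q).symm.trans
      this
  ker_le x hx := by
    rw [liftF_genFRT] at hx
    have := TwoSidedIdeal.mem_asIdeal.1 (Ideal.Quotient.eq_zero_iff_mem.1 hx)
    simpa using this

/-- The projection `A(c) → A(c,t)` as an algebra map. -/
def projAlgHom : FRTBialgebra b c →ₐ[k] InfFRTBialgebra b c t :=
  Ideal.Quotient.mkₐ k (relIdeal (coeff b t) (genFRT b c))

lemma liftF_genInfFRT (x : F k ι) :
    liftF (k := k) (genInfFRT b c t) x = projAlgHom b c t (liftF (k := k) (genFRT b c) x) := by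
  have h : liftF (k := k) (genInfFRT b c t) = (projAlgHom b c t).comp (liftF (genFRT b c)) :=
    algHomF_ext fun i j => by
      rw [liftF_genF, AlgHom.comp_apply, liftF_genF]
      rfl
  rw [h, AlgHom.comp_apply]

lemma projAlgHom_eq_zero_iff (x : FRTBialgebra b c) :
    projAlgHom b c t x = 0 ↔ x ∈ relIdeal (coeff b t) (genFRT b c) :=
  Ideal.Quotient.eq_zero_iff_mem

lemma comul_genInfFRT (i j : ι) : Coalgebra.comul (R := k) (genInfFRT b c t i j) =
    ∑ p, genInfFRT b c t i p ⊗ₜ[k] genInfFRT b c t p j := by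
  rw [genInfFRT, ← CoalgHomClass.map_comp_comul_apply, comul_genFRT, map_sum]
  rfl

lemma counit_genInfFRT (i j : ι) :
    Coalgebra.counit (R := k) (genInfFRT b c t i j) = if i = j then 1 else 0 := by
  rw [genInfFRT, CoalgHomClass.counit_comp_apply, counit_genFRT]

lemma rel_genInfFRT (s : ι → ι → ι → ι → k) (i j p q : ι) :
    rel s (genInfFRT b c t) i j p q = projAlgHom b c t (rel s (genFRT b c) i j p q) :=
  (map_rel s (genFRT b c) (projAlgHom b c t) i j p q).symm

/-- The third isomorphism theorem: the quotient of the free algebra by both families of relations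
receives a map from `A(c)`, and this map kills `I(t)`. -/
lemma mem_span_of_mem_relIdeal {x : F k ι}
    (hx : liftF (k := k) (genFRT b c) x ∈ relIdeal (coeff b t) (genFRT b c)) :
    x ∈ TwoSidedIdeal.span {x : F k ι | ∃ s ∈ ({coeff b c, coeff b t} : Set _), ∃ i j p q,
      x = rel s (genF k) i j p q} := by
  generalize hJ : TwoSidedIdeal.span {x : F k ι | ∃ s ∈ ({coeff b c, coeff b t} : Set _),
    ∃ i j p q, x = rel s (genF k) i j p q} = J
  have hrel : ∀ s ∈ ({coeff b c, coeff b t} : Set _), ∀ i j p q,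
      rel s (fun i j => Ideal.Quotient.mkₐ k J.asIdeal (genF k i j)) i j p q = 0 := by
    intro s hs i j p q
    rw [← map_rel]
    refine Ideal.Quotient.eq_zero_iff_mem.2 (TwoSidedIdeal.mem_asIdeal.2 ?_)
    rw [← hJ]
    exact TwoSidedIdeal.subset_span ⟨s, hs, i, j, p, q, rfl⟩
  obtain ⟨φ, hφ⟩ := (isPresentation_genFRT b c).exists_lift
    (fun i j => Ideal.Quotient.mkₐ k J.asIdeal (genF k i j)) fun s hs => hrel s (Or.inl hs)
  have hφx := relIdeal_le_ker (coeff b t) (genFRT b c) φ (fun i j p q => by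
    rw [map_rel]
    simpa only [hφ] using hrel _ (Or.inr rfl) i j p q) hx
  have hcomp : φ.comp (liftF (k := k) (genFRT b c)) = Ideal.Quotient.mkₐ k J.asIdeal :=
    algHomF_ext fun i j => by rw [AlgHom.comp_apply, liftF_genF, hφ]
  have hx' : Ideal.Quotient.mkₐ k J.asIdeal x = 0 := by
    rw [← hcomp]
    exact hφx
  exact TwoSidedIdeal.mem_asIdeal.1 (Ideal.Quotient.eq_zero_iff_mem.1 hx')

lemma isPresentation_genInfFRT : IsPresentation {coeff b c, coeff b t} (genInfFRT b c t) where
  comul := comul_genInfFRT b c t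
  counit := counit_genInfFRT b c t
  surjective x := by
    obtain ⟨y, rfl⟩ := Ideal.Quotient.mk_surjective x
    obtain ⟨z, rfl⟩ := (isPresentation_genFRT b c).surjective y
    exact ⟨z, liftF_genInfFRT b c t z⟩
  rel_eq_zero := by
    rintro s (rfl | rfl) i j p q
    · rw [rel_genInfFRT, (isPresentation_genFRT b c).rel_eq_zero _ rfl, map_zero]
    · rw [rel_genInfFRT, projAlgHom_eq_zero_iff]
      exact rel_mem _ _ i j p q
  ker_le x hx := by
    rw [liftF_genInfFRT, projAlgHom_eq_zero_iff] at hx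
    exact mem_span_of_mem_relIdeal b c t hx

end FRT

/-! ### The FRT structure, its descent and its first order deformation -/

section Existence

variable {k V ι : Type*} [Field k] [AddCommGroup V] [Module k V] [Fintype ι] [DecidableEq ι]
  (b : Module.Basis ι k V)

/-- Makes the FRT structure on `A(c)` the case `t = 0` of the deformed construction. -/
lemma IsBraided.isInfinitesimallyBraided_zero {c : (V ⊗[k] V) ≃ₗ[k] (V ⊗[k] V)}
    (h : IsBraided c) : IsInfinitesimallyBraided c 0 := by
  have h12 : leg12 (0 : Module.End k (V ⊗[k] V)) = 0 := by simp [leg12]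
  have h23 : leg23 (0 : Module.End k (V ⊗[k] V)) = 0 := by simp [leg23]
  constructor <;> simp [h12, h23, h]

lemma deformedMatrix_apply {K : Type*} [CommRing K] [Algebra k K] (e : K)
    (c t : Module.End k (V ⊗[k] V)) (i j p q : ι) :
    deformedMatrix b e c t (i, j) (p, q) =
      algebraMap k K (coeff b c i j p q) + e * algebraMap k K (coeff b (t * c) i j p q) := by
  rw [deformedMatrix, ← coeffMatrix_mul]
  rfl

lemma coeff_mul (c t : Module.End k (V ⊗[k] V)) (i j p q : ι) :
    coeff b (t * c) i j p q = ∑ m, ∑ n, coeff b c i j m n * coeff b t m n p q := by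
  have := congrFun₂ (coeffMatrix_mul b (K := k) t c) (i, j) (p, q)
  simpa [coeffMatrix, relMatrix, Matrix.mul_apply, Fintype.sum_prod_type] using this

lemma exists_isFRTStructure {c : (V ⊗[k] V) ≃ₗ[k] (V ⊗[k] V)} (h : IsBraided c) :
    ∃ R : (ConvForm k (FRTBialgebra b c.toLinearMap))ˣ, IsFRTStructure b c.toLinearMap R := by
  have hT := isPresentation_genFRT b c.toLinearMap
  obtain ⟨R, hR, hq, hv⟩ := h.isInfinitesimallyBraided_zero.exists_bicharacter b hT
    (fun s hs => Or.inl hs) (hT.rel_eq_zero _ rfl) (fun i j p q => by simp [rel, coeff])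
    (mul_zero (0 : k))
  refine ⟨R, hR.isCoquasitriangular hq, fun i j p q => ?_⟩
  rw [hv, deformedMatrix_apply]
  simp

lemma IsFRTStructure.unique {c : Module.End k (V ⊗[k] V)} {R R' : (ConvForm k (FRTBialgebra b c))ˣ}
    (hR : IsFRTStructure b c R) (hR' : IsFRTStructure b c R') : R = R' :=
  Units.ext ((isPresentation_genFRT b c).bicharacter_ext hR.coquasitriangular.isBicharacter
    hR'.coquasitriangular.isBicharacter fun i j p q => by rw [hR.gen, hR'.gen])

/-- The deformed `R`-matrix `c(1 + e t)` extends to a bicharacter of `A(c,t)`. -/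
lemma IsInfinitesimallyBraided.exists_bicharacter_infFRT {c : (V ⊗[k] V) ≃ₗ[k] (V ⊗[k] V)}
    {t : Module.End k (V ⊗[k] V)} (h : IsInfinitesimallyBraided c t) {K : Type*} [CommRing K]
    [Algebra k K] {e : K} (he : e * e = 0) :
    ∃ R : (WithConv (InfFRTBialgebra b c.toLinearMap t ⊗[k] InfFRTBialgebra b c.toLinearMap t
        →ₗ[k] K))ˣ, IsBicharacter R.val ∧ IsQuasiCommutative R.val ∧
      ∀ i j p q, R.val.ofConv
        (genInfFRT b c.toLinearMap t i p ⊗ₜ genInfFRT b c.toLinearMap t j q) =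
          algebraMap k K (coeff b c.toLinearMap j i p q) +
            e * algebraMap k K (coeff b (t * c.toLinearMap) j i p q) := by
  have hT := isPresentation_genInfFRT b c.toLinearMap t
  obtain ⟨R, hR, hq, hv⟩ := h.exists_bicharacter b hT (fun s hs => hs)
    (hT.rel_eq_zero _ (Or.inl rfl)) (hT.rel_eq_zero _ (Or.inr rfl)) he
  exact ⟨R, hR, hq, fun i j p q => by rw [hv, deformedMatrix_apply]⟩

/-- There is no need to show that `R` vanishes on the ideal: the pullback of `R'` is a bicharacter
on `A(c)` with the values of `R` on generators, hence equals `R`. -/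
lemma descends_of_isBicharacter {c t : Module.End k (V ⊗[k] V)}
    {R : (ConvForm k (FRTBialgebra b c))ˣ} (hR : IsFRTStructure b c R)
    {R' : (ConvForm k (InfFRTBialgebra b c t))ˣ} (hR' : IsBicharacter R'.val)
    (hv : ∀ i j p q, R'.val.ofConv (genInfFRT b c t i p ⊗ₜ genInfFRT b c t j q) =
      coeff b c j i p q) : Descends b c t R R' := by
  have h1 := (isPresentation_genFRT b c).bicharacter_ext (hR'.pull (proj b c t))
    hR.coquasitriangular.isBicharacter fun i j p q => by
      rw [hR.gen, ← hv]
      rfl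
  intro x y
  rw [← h1]
  rfl

/-- The row swap in the values of `R` only affects the left factor of `CT`, so removing `R` leaves
the matrix of `t` with unswapped indices. -/
lemma genMatrix_sndForm {c t : Module.End k (V ⊗[k] V)} {R : ConvForm k (InfFRTBialgebra b c t)}
    {f : WithConv (InfFRTBialgebra b c t ⊗[k] InfFRTBialgebra b c t →ₗ[k] DualNumber k)}
    (hR : ∀ i j p q, R.ofConv (genInfFRT b c t i p ⊗ₜ genInfFRT b c t j q) = coeff b c j i p q)
    (hf : ∀ i j p q, f.ofConv (genInfFRT b c t i p ⊗ₜ genInfFRT b c t j q) =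
      algebraMap k _ (coeff b c j i p q) +
        DualNumber.eps * algebraMap k _ (coeff b (t * c) j i p q)) :
    genMatrix (genInfFRT b c t) (sndForm f) =
      genMatrix (genInfFRT b c t) R * coeffMatrix b k t := by
  ext ⟨i, j⟩ ⟨p, q⟩
  have h : (sndForm f).ofConv (genInfFRT b c t i p ⊗ₜ genInfFRT b c t j q) =
      coeff b (t * c) j i p q := by
    rw [sndForm_apply, hf]
    simp [TrivSqZeroExt.algebraMap_eq_inl]
  simp only [genMatrix, Matrix.of_apply, Matrix.mul_apply, Fintype.sum_prod_type, hR]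
  exact h.trans (coeff_mul b c t j i p q)

end Existence

end InfFRT

end

theorem mainTheorem4 {k V ι : Type*} [Field k] [AddCommGroup V] [Module k V]
    [Fintype ι] [DecidableEq ι] (b : Module.Basis ι k V)
    (c : (V ⊗[k] V) ≃ₗ[k] (V ⊗[k] V)) (t : Module.End k (V ⊗[k] V))
    (h : InfFRT.IsInfinitesimallyBraided c t) :
    (∃! R : (InfFRT.ConvForm k (InfFRT.FRTBialgebra b c.toLinearMap))ˣ,
      InfFRT.IsFRTStructure b c.toLinearMap R) ∧
    ∀ R : (InfFRT.ConvForm k (InfFRT.FRTBialgebra b c.toLinearMap))ˣ,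
      InfFRT.IsFRTStructure b c.toLinearMap R →
      ∃ R' : (InfFRT.ConvForm k (InfFRT.InfFRTBialgebra b c.toLinearMap t))ˣ,
        InfFRT.Descends b c.toLinearMap t R R' ∧ InfFRT.IsCoquasitriangular R' ∧
        ∃! χ : InfFRT.ConvForm k (InfFRT.InfFRTBialgebra b c.toLinearMap t),
          InfFRT.IsInfinitesimalRForm R' χ ∧
            ∀ i j p q : ι, χ.ofConv
              (InfFRT.genInfFRT b c.toLinearMap t i p ⊗ₜ[k]
                InfFRT.genInfFRT b c.toLinearMap t j q) = InfFRT.coeff b t i j p q := by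
  obtain ⟨R₀, hR₀⟩ := InfFRT.exists_isFRTStructure b h.braid
  refine ⟨⟨R₀, hR₀, fun R hR => hR.unique b hR₀⟩, fun R hR => ?_⟩
  have hT := InfFRT.isPresentation_genInfFRT b c.toLinearMap t
  -- One construction is used twice: with `K = k`, `e = 0` for the structure `R'`, and with the dual
  -- numbers, `e = ε`, for its deformation `f`.
  obtain ⟨R', hR', hq', hv'⟩ := h.exists_bicharacter_infFRT b (mul_zero (0 : k))
  obtain ⟨f, hf, hq, hv⟩ := h.exists_bicharacter_infFRT b (DualNumber.eps_mul_eps (R := k))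
  simp only [Algebra.algebraMap_self, RingHom.id_apply, zero_mul, add_zero] at hv'
  have hco := hR'.isCoquasitriangular hq'
  have hfst : InfFRT.fstForm f.val = R'.val :=
    hT.bicharacter_ext hf.fstForm hR' fun i j p q => by
      rw [InfFRT.fstForm_apply, hv, hv']
      simp [TrivSqZeroExt.algebraMap_eq_inl]
  -- On generators the candidate `χ = R'⁻¹ * sndForm f` has matrix `R'⁻¹(R'T) = T`.
  have hgen : InfFRT.genMatrix (InfFRT.genInfFRT b c.toLinearMap t)
      (R'⁻¹.val * InfFRT.sndForm f.val) = InfFRT.coeffMatrix b k t := by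
    rw [hT.genMatrix_mul, InfFRT.genMatrix_sndForm b hv' hv, ← mul_assoc, ← hT.genMatrix_mul,
      Units.inv_mul, hT.genMatrix_one, one_mul]
  have hχ := hco.isInfinitesimalRForm hf hq hfst
  refine ⟨R', InfFRT.descends_of_isBicharacter b hR hR' hv', hco,
    R'⁻¹.val * InfFRT.sndForm f.val, ⟨hχ, fun i j p q => congrFun₂ hgen (i, j) (p, q)⟩,
    fun χ hχ' => hT.infinitesimalRForm_ext hco hχ'.1 hχ ?_⟩
  rw [hgen]
  ext ⟨i, j⟩ ⟨p, q⟩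
  exact hχ'.2 i j p q
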